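/- Let $X$ be a separable Banach space and $\mu_0$ a Gaussian measure on $X$ with mean zero and Cameron--Martin space $(E,\langle\cdot,\cdot\rangle_E)$. For $h\in E$ write $u\mapsto\langle u,h\rangle_E$ ($u\in X$) also for the measurable linear functional associated with $h$: any linear functional on $X$ that coincides $\mu_0$-almost everywhere with the element $\hat h$ of the $L^2(\mu_0)$-closure of $X^*$ for which $h=\int \hat h(x)\,x\,\mu_0(\mathrm dx)$. Let $\Lambda\subseteq\mathbb R^k$, let $S\subseteq\Lambda$ be compact, and let $\nu_0$ be a probability measure on $\mathbb R^k$ with Lebesgue density $\rho\ge 0$ such that $\rho=0$ off $S$, $\rho>0$ on $\mathrm{int}(S)$, and $\rho$ is continuously differentiable on $S$. Let $\Phi:X\times\Lambda\to\mathbb R$ be bounded and measurable, and (Fréchet) differentiable on $X\times\mathrm{int}(\Lambda)$ with uniformly bounded derivative. Let $$\mu(\mathrm du,\mathrm da)=\tfrac1Z\,e^{-\Phi(u,a)}\,\mu_0(\mathrm du)\,\nu_0(\mathrm da)$$ with normalising constant $Z$, and let $I(u,a)=\Phi(u,a)+J(u)+K(a)$, where $J(u)=\frac12\|u\|_E^2$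 for $u\in E$ and $J(u)=\infty$ otherwise, while $K=-\log\rho$ on $\mathrm{int}(S)$, $K$ is the limit of $-\log\rho$ from the interior on $\partial S$, and $K=\infty$ off $S$. For a finite measure $\lambda$, a vector $z$ and a Borel set $A$ put $d_z\lambda(A)=\lim_{t\to0}\frac{\lambda(A+tz)-\lambda(A)}{t}$ when this finite limit exists. The measure $\lambda$ is Fomin differentiable along $z$ if $d_z\lambda(A)$ exists for every Borel set $A$; the density of $d_z\lambda$ with respect to $\lambda$ is the logarithmic derivative $\beta^\lambda_z$. We say that $\beta$ is the logarithmic derivative of $\lambda$ along $z$ within $U$ if, for every Borel set $A$ for which there is $\varepsilon>0$ with $A+tz\subseteq U$ whenever $|t|<\varepsilon$, the function $\beta$ is $\lambda$-integrable over $A$, $d_z\lambda(A)$ exists, and $d_z\lambda(A)=\int_A\beta\,\mathrm d\lambda$. Then functionals $\langle\cdot,h\rangle_E$ as above exist for all $h\in E$, and any choice of them coincides on $E$ with the inner product of $E$. For every choice, with $$\beta_{(h,b)}(u,a):=-\partial_{(h,b)}\Phi(u,a)-\langle u,h\rangle_E+\partial_b\log\rho(a),$$ the following hold. 1. For all $(h,b)\in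 E\times\mathbb R^k$, $\beta_{(h,b)}$ is the logarithmic derivative of $\mu$ along $(h,b)$ within $X\times\mathrm{int}(S)$. If moreover $\rho=0$ on $\partial S$, then for all $(h,b)\in E\times\mathbb R^k$ the measure $\mu$ is Fomin differentiable along $(h,b)$ and $\beta_{(h,b)}$ is its logarithmic derivative $\beta^\mu_{(h,b)}$. 2. For all $(u,a)\in E\times\mathrm{int}(S)$ and $(h,b)\in E\times\mathbb R^k$, the derivative $\partial_{(h,b)}I(u,a)$ exists and $\beta_{(h,b)}(u,a)=-\partial_{(h,b)}I(u,a)$. 3. A point $(\hat u,\hat a)\in E\times\mathrm{int}(S)$ is a critical point of $I$ (that is, $I$, as a function on $E\times\mathrm{int}(S)$ with the norm of $E\times\mathbb R^k$, is Fréchet differentiable at $(\hat u,\hat a)$ with derivative zero) if and only if $\beta_{(h,b)}(\hat u,\hat a)=0$ for all $(h,b)\in E\times\mathbb R^k$. -/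

import Mathlib

open MeasureTheory ProbabilityTheory Filter Topology Set
open scoped ENNReal

/-! ### Cameron-Martin space of a centred Gaussian measure -/

section CameronMartin

variable {X : Type*} [NormedAddCommGroup X] [NormedSpace ℝ X] [MeasurableSpace X] [BorelSpace X]

/-- The Cameron-Martin space `E` of a centred Gaussian measure `μ` on a Banach space, realised as
the closure in `L²(μ)` of the continuous linear functionals, with the inner product of `L²(μ)`.
The element `ĥ` of this closure stands for the vector `h = ∫ ĥ(x) x μ(dx)` of `X`
(see `CameronMartin.toX`), and by definition `⟨g, h⟩_E = ⟨ĝ, ĥ⟩_{L²(μ)}`. -/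
abbrev CameronMartin (μ : Measure X) : Type _ :=
  ↥(LinearMap.range (StrongDual.toLp (𝕜 := ℝ) μ 2).toLinearMap).topologicalClosure

/-- The embedding `E → X`, `h = ∫ ĥ(x) x μ(dx)`. -/
noncomputable def CameronMartin.toX {μ : Measure X} (h : CameronMartin μ) : X :=
  ∫ x, (h : Lp ℝ 2 μ) x • x ∂μ

/-- `ℓ` is a version of the measurable linear functional `u ↦ ⟨u, h⟩_E` on `X`, i.e. a linear
functional that agrees `μ`-almost everywhere with the `L²(μ)`-limit `ĥ` of continuous linear
functionals. -/
def IsPairingVersion (μ : Measure X) (h : CameronMartin μ) (ℓ : X →ₗ[ℝ] ℝ) : Prop :=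
  (fun u => ℓ u) =ᵐ[μ] fun u => (h : Lp ℝ 2 μ) u

/-- Onsager-Machlup functional of a centred Gaussian measure: `‖u‖_E² / 2` if `u ∈ E`, and `∞`
otherwise (the infimum is over the at most one element of `E` that is mapped to `u`). -/
noncomputable def gaussianOM (μ : Measure X) (u : X) : EReal :=
  ⨅ (h : CameronMartin μ) (_ : h.toX = u), ((1 / 2 * ‖h‖ ^ 2 : ℝ) : EReal)

end CameronMartin

/-! ### Fomin derivative -/

section Fomin

variable {V : Type*} [AddCommGroup V] [Module ℝ V] [MeasurableSpace V]

/-- `lim_{t → 0} (lam (A + t z) - lam A) / t = d`. -/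
def HasFominDeriv (lam : Measure V) (z : V) (A : Set V) (d : ℝ) : Prop :=
  Tendsto (fun t : ℝ => (lam.real ((fun x => x + t • z) '' A) - lam.real A) / t) (𝓝[≠] 0) (𝓝 d)

/-- Fomin differentiability of `lam` along `z`: the finite limit exists for every measurable set. -/
def IsFominDifferentiable (lam : Measure V) (z : V) : Prop :=
  ∀ A : Set V, MeasurableSet A → ∃ d : ℝ, HasFominDeriv lam z A d

/-- `β` is the logarithmic derivative of `lam` along `z`: `lam` is Fomin differentiable along `z`
and `β` is the density of the set function `d_z lam` with respect to `lam`. -/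
def IsLogDeriv (lam : Measure V) (z : V) (β : V → ℝ) : Prop :=
  IsFominDifferentiable lam z ∧ Integrable β lam ∧
    ∀ A : Set V, MeasurableSet A → HasFominDeriv lam z A (∫ x in A, β x ∂lam)

/-- `β` is the logarithmic derivative of `lam` along `z` within `U`: as in `IsLogDeriv`, but only
for those measurable sets `A` all of whose small translates `A + t z` stay in `U`.
For `U = univ` this is the condition for all measurable sets. -/
def IsLogDerivWithin (lam : Measure V) (z : V) (U : Set V) (β : V → ℝ) : Prop :=
  ∀ A : Set V, MeasurableSet A →
    (∃ ε > 0, ∀ t : ℝ, |t| < ε → (fun x => x + t • z) '' A ⊆ U) →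
    IntegrableOn β A lam ∧ HasFominDeriv lam z A (∫ x in A, β x ∂lam)

end Fomin

/-! ### Posterior measure and its Onsager-Machlup functional -/

section Posterior

variable {X : Type*} [NormedAddCommGroup X] [NormedSpace ℝ X] [MeasurableSpace X] [BorelSpace X]
variable {k : ℕ}

/-- The measure on `ℝ^k` with Lebesgue density `ρ`. -/
noncomputable def paramPrior (ρ : EuclideanSpace ℝ (Fin k) → ℝ) :
    Measure (EuclideanSpace ℝ (Fin k)) :=
  volume.withDensity fun a => ENNReal.ofReal (ρ a)

/-- The posterior `Z⁻¹ exp (-Φ(u, a)) μ₀(du) ν₀(da)`, where `Z` is the normalising constant. -/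
noncomputable def bayesPosterior (μ₀ : Measure X) (ν₀ : Measure (EuclideanSpace ℝ (Fin k)))
    (Φ : X × EuclideanSpace ℝ (Fin k) → ℝ) : Measure (X × EuclideanSpace ℝ (Fin k)) :=
  (∫⁻ p, ENNReal.ofReal (Real.exp (-Φ p)) ∂(μ₀.prod ν₀))⁻¹ •
    (μ₀.prod ν₀).withDensity fun p => ENNReal.ofReal (Real.exp (-Φ p))

open Classical in
/-- Onsager-Machlup functional of the measure with density `ρ` on `S`: `-log ρ` on `int S`, the
limit of `-log ρ` from the interior on the boundary, and `∞` off `S`. -/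
noncomputable def paramOM (S : Set (EuclideanSpace ℝ (Fin k)))
    (ρ : EuclideanSpace ℝ (Fin k) → ℝ) (a : EuclideanSpace ℝ (Fin k)) : EReal :=
  if a ∈ interior S then ((-Real.log (ρ a) : ℝ) : EReal)
  else if a ∈ S then
    liminf (fun b => ((-Real.log (ρ b) : ℝ) : EReal)) (𝓝[interior S] a)
  else ⊤

/-- The functional `I(u, a) = Φ(u, a) + J(u) + K(a)`. -/
noncomputable def posteriorOM (μ₀ : Measure X) (S : Set (EuclideanSpace ℝ (Fin k)))
    (ρ : EuclideanSpace ℝ (Fin k) → ℝ) (Φ : X × EuclideanSpace ℝ (Fin k) → ℝ)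
    (p : X × EuclideanSpace ℝ (Fin k)) : EReal :=
  (Φ p : EReal) + gaussianOM μ₀ p.1 + paramOM S ρ p.2

/-- `I` as a real function on `E × ℝ^k`. On `E × int S`, an open subset of `E × ℝ^k`, the
functional `I` is finite, so that this is `I` itself there. -/
noncomputable def posteriorOMReal (μ₀ : Measure X) (S : Set (EuclideanSpace ℝ (Fin k)))
    (ρ : EuclideanSpace ℝ (Fin k) → ℝ) (Φ : X × EuclideanSpace ℝ (Fin k) → ℝ)
    (p : CameronMartin μ₀ × EuclideanSpace ℝ (Fin k)) : ℝ :=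
  (posteriorOM μ₀ S ρ Φ (p.1.toX, p.2)).toReal

/-- The function `-∂_{(h,b)} Φ(u, a) - ⟨u, h⟩_E + ∂_b log ρ(a)`, where `ℓ h` is a version of
`⟨·, h⟩_E`. -/
noncomputable def posteriorLogDeriv {μ₀ : Measure X} (ρ : EuclideanSpace ℝ (Fin k) → ℝ)
    (Φ : X × EuclideanSpace ℝ (Fin k) → ℝ) (ℓ : CameronMartin μ₀ → X →ₗ[ℝ] ℝ)
    (h : CameronMartin μ₀) (b : EuclideanSpace ℝ (Fin k))
    (p : X × EuclideanSpace ℝ (Fin k)) : ℝ :=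
  -lineDeriv ℝ Φ p (h.toX, b) - ℓ h p.1 + lineDeriv ℝ (fun a => Real.log (ρ a)) p.2 b

end Posterior

/-! With respect to `μ₀ ⊗ volume` the posterior has density `c * G`, where `G = exp (-Φ) * ρ`. By
the Cameron-Martin theorem (`CameronMartin.map_add_toX`) and translation invariance of Lebesgue
measure, translating by `t z`, `z = (h, b)`, moves `t` from the set into the integrand: the mass of
`A + t z` is `c` times the integral over `A` of `G (p + t z) exp (-t ĥ - t² ‖h‖² / 2)`.
Differentiating at `t = 0` under the integral gives `∂_z G - ĥ G`, which is `β G` wherever `ρ > 0`.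
Domination comes from a Lipschitz bound for `G` along lines, the exponential moments of the Gaussian
variable `ĥ`, and the compactness of `S`.

Within `X × int S` the lines stay where `G` is differentiable. If `ρ = 0` on the boundary, lines may
cross it: `G` vanishes off the open set and has bounded derivative inside, so it is still Lipschitz
along lines. By Rademacher's theorem the Lipschitz function `ρ` is differentiable almost everywhere,
with derivative zero at such zeros because they are minima; `G ≤ const * ρ` inherits this. The
boundary of `S` may therefore have positive volume.

The Cameron-Martin theorem is proved with characteristic functions: elements of `E` are centred
Gaussian variables, and orthogonal ones are independent. It also shows that a linear version of `⟨·,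
h⟩_E`, fixed only almost everywhere, is determined on the null set `E`: translation by `u ∈ E`
preserves full-measure sets. Hence on `E × int S` the derivative of `Φ + ‖u‖² / 2 - log ρ` is
exactly `-β`. -/

/-- Integration against `exp (i ·)` is continuous on `L²`. -/
lemma continuous_integral_cexp_Lp {Ω : Type*} [MeasurableSpace Ω] (μ : Measure Ω) [IsProbabilityMeasure μ] :
    Continuous fun v : Lp ℝ 2 μ => ∫ x, Complex.exp (v x * Complex.I) ∂μ := by
  have hint : ∀ v : Lp ℝ 2 μ, Integrable (fun x => Complex.exp (v x * Complex.I)) μ := by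
    intro v
    refine (integrable_const (1 : ℝ)).mono' ?_ (ae_of_all _ fun x => ?_)
    · have := (Lp.aestronglyMeasurable v).aemeasurable
      exact (by fun_prop : AEMeasurable (fun x => Complex.exp (v x * Complex.I)) μ).aestronglyMeasurable
    · rw [Complex.norm_exp_ofReal_mul_I]
  -- The constant 1 comes from `|exp (ia) - exp (ib)| ≤ |a - b|` and `L¹ ≤ L²` on a probability
  -- space.
  refine (LipschitzWith.of_dist_le_mul (K := 1) fun v w => ?_).continuous
  rw [dist_eq_norm, ← integral_sub (hint v) (hint w), dist_eq_norm, NNReal.coe_one, one_mul]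
  have h2 : MemLp (v - w : Lp ℝ 2 μ) 2 μ := Lp.memLp _
  have h1 : Integrable (v - w : Lp ℝ 2 μ) μ := h2.integrable (by norm_num)
  calc ‖∫ x, (Complex.exp (v x * Complex.I) - Complex.exp (w x * Complex.I)) ∂μ‖
      ≤ ∫ x, ‖(v - w : Lp ℝ 2 μ) x‖ ∂μ := by
        refine norm_integral_le_of_norm_le h1.norm ?_
        filter_upwards [Lp.coeFn_sub v w] with x hx
        rw [hx, Pi.sub_apply]
        have e : Complex.exp (v x * Complex.I) - Complex.exp (w x * Complex.I)
            = Complex.exp (w x * Complex.I) *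
              (Complex.exp (Complex.I * ((v x - w x : ℝ) : ℂ)) - 1) := by
          rw [mul_sub, ← Complex.exp_add, mul_one]
          push_cast
          ring_nf
        rw [e, norm_mul, Complex.norm_exp_ofReal_mul_I, one_mul]
        exact Real.norm_exp_I_mul_ofReal_sub_one_le
    _ = (eLpNorm (v - w : Lp ℝ 2 μ) 1 μ).toReal := by
        rw [integral_norm_eq_lintegral_enorm h1.aestronglyMeasurable, eLpNorm_one_eq_lintegral_enorm]
    _ ≤ (eLpNorm (v - w : Lp ℝ 2 μ) 2 μ).toReal :=
        ENNReal.toReal_mono h2.eLpNorm_ne_top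
          (eLpNorm_le_eLpNorm_of_exponent_le (by norm_num) h1.aestronglyMeasurable)
    _ = ‖v - w‖ := by rw [Lp.norm_def]

lemma real_inner_Lp_eq_integral {Ω : Type*} [MeasurableSpace Ω] {μ : Measure Ω} (v w : Lp ℝ 2 μ) : inner ℝ v w = ∫ x, v x * w x ∂μ := by
  rw [L2.inner_def]
  simp [mul_comm]

lemma norm_smul_add_smul_sq_of_inner_eq_zero {F : Type*} [NormedAddCommGroup F]
    [InnerProductSpace ℝ F] {g h : F} (hgh : inner ℝ g h = 0) (a b : ℝ) :
    ‖a • g + b • h‖ ^ 2 = ‖a • g‖ ^ 2 + ‖b • h‖ ^ 2 := by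
  rw [norm_add_sq_real, real_inner_smul_left, real_inner_smul_right, hgh]
  simp

/-- Projection onto the line of `h`. For `h = 0` the quotient defining `c` is `0`, and the
decomposition remains valid. -/
lemma exists_eq_smul_add_orthogonal {F : Type*} [NormedAddCommGroup F]
    [InnerProductSpace ℝ F] (g h : F) :
    ∃ (c : ℝ) (g' : F), g = c • h + g' ∧ inner ℝ h g' = 0 ∧
      ‖g‖ ^ 2 = c ^ 2 * ‖h‖ ^ 2 + ‖g'‖ ^ 2 ∧ inner ℝ g h = c * ‖h‖ ^ 2 := by
  have horth : inner ℝ h (g - (inner ℝ h g / ‖h‖ ^ 2) • h) = 0 := by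
    rcases eq_or_ne h 0 with rfl | hh
    · simp
    · rw [inner_sub_right, real_inner_smul_right, real_inner_self_eq_norm_sq]
      have : ‖h‖ ≠ 0 := norm_ne_zero_iff.mpr hh
      field_simp
      ring
  set c := inner ℝ h g / ‖h‖ ^ 2
  have hg : g = c • h + (g - c • h) := by abel
  refine ⟨c, g - c • h, hg, horth, ?_, ?_⟩
  · conv_lhs => rw [hg]
    have := norm_smul_add_smul_sq_of_inner_eq_zero horth c 1
    rw [one_smul] at this
    rw [this, norm_smul, mul_pow]
    simp
  · conv_lhs => rw [hg]
    rw [inner_add_left, real_inner_smul_left, real_inner_self_eq_norm_sq,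
      real_inner_comm, horth]
    simp

/-! ### Gaussian variables, the Cameron-Martin theorem and versions of the pairing -/

section CameronMartinTheory

variable {X : Type*} [NormedAddCommGroup X] [NormedSpace ℝ X] [MeasurableSpace X] [BorelSpace X]

variable [CompleteSpace X] [SecondCountableTopology X]
variable {μ : Measure X} [IsGaussian μ]

lemma strongDual_toLp_coeFn (f : StrongDual ℝ X) :
    (StrongDual.toLp (𝕜 := ℝ) μ 2 f : X → ℝ) =ᵐ[μ] f := by
  rw [StrongDual.toLp_apply (IsGaussian.memLp_id μ 2 (by norm_num))]
  exact MemLp.coeFn_toLp _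

lemma variance_strongDual (hmean : ∫ x, x ∂μ = 0) (f : StrongDual ℝ X) :
    Var[f; μ] = ‖StrongDual.toLp (𝕜 := ℝ) μ 2 f‖ ^ 2 := by
  rw [← real_inner_self_eq_norm_sq, real_inner_Lp_eq_integral, variance_of_integral_eq_zero]
  · refine integral_congr_ae ?_
    filter_upwards [strongDual_toLp_coeFn (μ := μ) f] with x hx
    rw [hx, sq]
  · exact f.continuous.aemeasurable
  · rw [IsGaussian.integral_dual, hmean, map_zero]

/-- The element of the Cameron-Martin space given by a continuous linear functional. -/
noncomputable def CameronMartin.ofDual (μ : Measure X) (f : StrongDual ℝ X) : CameronMartin μ :=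
  ⟨StrongDual.toLp (𝕜 := ℝ) μ 2 f, Submodule.le_topologicalClosure _ ⟨f, rfl⟩⟩

/-- Every element of the Cameron-Martin space is a centred Gaussian random variable. -/
lemma CameronMartin.integral_cexp (hmean : ∫ x, x ∂μ = 0) (h : CameronMartin μ) :
    ∫ x, Complex.exp ((h : Lp ℝ 2 μ) x * Complex.I) ∂μ = Complex.exp (-(‖h‖ : ℂ) ^ 2 / 2) := by
  -- Both sides are continuous on `L²`, so the identity passes from continuous functionals to their
  -- closure.
  have hcl : IsClosed {v : Lp ℝ 2 μ | ∫ x, Complex.exp (v x * Complex.I) ∂μ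
      = Complex.exp (-(‖v‖ : ℂ) ^ 2 / 2)} :=
    isClosed_eq (continuous_integral_cexp_Lp μ) (by fun_prop)
  refine closure_minimal ?_ hcl h.2
  rintro _ ⟨f, rfl⟩
  have key := IsGaussian.charFunDual_eq_of_integral_eq_zero (μ := μ) hmean f
  rw [variance_strongDual hmean, charFunDual_apply] at key
  simp only [Set.mem_ofPred_eq]
  push_cast at key
  refine Eq.trans (integral_congr_ae ?_) key
  filter_upwards [strongDual_toLp_coeFn (μ := μ) f] with x hx
  simpa using congrArg (fun r : ℝ => Complex.exp (r * Complex.I)) hx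

/-- The multiples `t • h` also lie in `E`, so `CameronMartin.integral_cexp` supplies the whole
characteristic function of `ĥ`. -/
lemma CameronMartin.map_eq_gaussianReal (hmean : ∫ x, x ∂μ = 0) (h : CameronMartin μ) :
    μ.map (h : Lp ℝ 2 μ) = gaussianReal 0 (‖h‖₊ ^ 2) := by
  have hm : AEMeasurable (h : Lp ℝ 2 μ) μ := (Lp.aestronglyMeasurable _).aemeasurable
  have := Measure.isProbabilityMeasure_map hm
  refine Measure.ext_of_charFun ?_
  ext t
  rw [charFun_gaussianReal, charFun_apply, integral_map hm (by fun_prop)]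
  have key := CameronMartin.integral_cexp hmean (t • h)
  rw [norm_smul] at key
  convert key using 1
  · refine integral_congr_ae ?_
    filter_upwards [Lp.coeFn_smul t (h : Lp ℝ 2 μ)] with x hx
    rw [Submodule.coe_smul, hx]
    simp
  · congr 1
    have : ((|t| : ℝ) : ℂ) ^ 2 = (t : ℂ) ^ 2 := by exact_mod_cast sq_abs t
    simp only [Real.norm_eq_abs]
    push_cast
    rw [mul_pow, this]
    simp; ring

/-- Orthogonal elements of the Cameron-Martin space are independent random variables. -/
lemma CameronMartin.indepFun_of_inner_eq_zero (hmean : ∫ x, x ∂μ = 0) (g h : CameronMartin μ)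
    (hgh : inner ℝ g h = 0) : IndepFun (g : Lp ℝ 2 μ) (h : Lp ℝ 2 μ) μ := by
  have hg : AEMeasurable (g : Lp ℝ 2 μ) μ := (Lp.aestronglyMeasurable _).aemeasurable
  have hh : AEMeasurable (h : Lp ℝ 2 μ) μ := (Lp.aestronglyMeasurable _).aemeasurable
  rw [indepFun_iff_charFunDual_prod hg hh]
  intro L
  have hL : ∀ a b : ℝ, L (a, b) = L (1, 0) * a + L (0, 1) * b := by
    intro a b
    have : ((a, b) : ℝ × ℝ) = a • (1, 0) + b • (0, 1) := by simp
    rw [this, map_add, map_smul, map_smul, smul_eq_mul, smul_eq_mul]; ring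
  set α := L (1, 0)
  set β := L (0, 1)
  have single : ∀ (c : ℝ) (v : CameronMartin μ),
      ∫ x, Complex.exp ((c * (v : Lp ℝ 2 μ) x : ℝ) * Complex.I) ∂μ
        = Complex.exp (-(‖c • v‖ : ℂ) ^ 2 / 2) := by
    intro c v
    rw [← CameronMartin.integral_cexp hmean]
    refine integral_congr_ae ?_
    filter_upwards [Lp.coeFn_smul c (v : Lp ℝ 2 μ)] with x hx
    rw [Submodule.coe_smul, hx]
    simp
  -- The joint characteristic function is that of the single element `α • g + β • h`; by Pythagoras
  -- its squared norm splits, so the function factorises.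
  have joint : ∫ x, Complex.exp ((α * (g : Lp ℝ 2 μ) x + β * (h : Lp ℝ 2 μ) x : ℝ) * Complex.I) ∂μ
        = Complex.exp (-(‖α • g + β • h‖ : ℂ) ^ 2 / 2) := by
    rw [← CameronMartin.integral_cexp hmean]
    refine integral_congr_ae ?_
    filter_upwards [Lp.coeFn_smul α (g : Lp ℝ 2 μ), Lp.coeFn_smul β (h : Lp ℝ 2 μ),
      Lp.coeFn_add (α • (g : Lp ℝ 2 μ)) (β • (h : Lp ℝ 2 μ))] with x h1 h2 h3
    rw [Submodule.coe_add, Submodule.coe_smul, Submodule.coe_smul, h3, Pi.add_apply, h1, h2]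
    simp
  rw [charFunDual_apply, charFunDual_apply, charFunDual_apply,
    integral_map (hg.prodMk hh) (by fun_prop), integral_map hg (by fun_prop),
    integral_map hh (by fun_prop)]
  have e1 : ∀ a : ℝ, L.comp (.inl ℝ ℝ ℝ) a = α * a := fun a => by simp [hL a 0]
  have e2 : ∀ a : ℝ, L.comp (.inr ℝ ℝ ℝ) a = β * a := fun a => by simp [hL 0 a]
  simp only [e1, e2, hL]
  rw [single, single, joint, ← Complex.exp_add]
  congr 1
  have := norm_smul_add_smul_sq_of_inner_eq_zero hgh α β
  have : (‖α • g + β • h‖ : ℂ) ^ 2 = (‖α • g‖ : ℂ) ^ 2 + (‖β • h‖ : ℂ) ^ 2 := by exact_mod_cast this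
  rw [this]; ring

/-- Fourier transform of the measure tilted by `exp ĥ`. With `g = c • h + g'` and `g'` independent
of `h`, one factor is the complex moment generating function of a real Gaussian at `1 + c i`, the
other a characteristic function. -/
lemma CameronMartin.integral_cexp_mul_exp (hmean : ∫ x, x ∂μ = 0) (g h : CameronMartin μ) :
    ∫ x, Complex.exp ((g : Lp ℝ 2 μ) x * Complex.I) * Complex.exp ((h : Lp ℝ 2 μ) x) ∂μ
      = Complex.exp ((‖h‖ : ℂ) ^ 2 / 2 + (inner ℝ g h : ℝ) * Complex.I - (‖g‖ : ℂ) ^ 2 / 2) := by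
  obtain ⟨c, g', hg, horth, n1, n2⟩ := exists_eq_smul_add_orthogonal g h
  have hind := CameronMartin.indepFun_of_inner_eq_zero hmean h g' horth
  have hmh : AEMeasurable (h : Lp ℝ 2 μ) μ := (Lp.aestronglyMeasurable _).aemeasurable
  have hmg : AEMeasurable (g' : Lp ℝ 2 μ) μ := (Lp.aestronglyMeasurable _).aemeasurable
  have hind' : IndepFun (fun x => Complex.exp ((1 + c * Complex.I) * (h : Lp ℝ 2 μ) x))
      (fun x => Complex.exp ((g' : Lp ℝ 2 μ) x * Complex.I)) μ :=
    hind.comp (φ := fun r : ℝ => Complex.exp ((1 + c * Complex.I) * r))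
      (ψ := fun r : ℝ => Complex.exp (r * Complex.I)) (by fun_prop) (by fun_prop)
  have e1 : ∫ x, Complex.exp ((1 + c * Complex.I) * (h : Lp ℝ 2 μ) x) ∂μ
      = Complex.exp ((‖h‖ : ℂ) ^ 2 * (1 + c * Complex.I) ^ 2 / 2) := by
    have := complexMGF_gaussianReal (CameronMartin.map_eq_gaussianReal hmean h) (1 + c * Complex.I)
    simpa [complexMGF] using this
  have e2 := CameronMartin.integral_cexp hmean g'
  calc _ = ∫ x, Complex.exp ((1 + c * Complex.I) * (h : Lp ℝ 2 μ) x) *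
            Complex.exp ((g' : Lp ℝ 2 μ) x * Complex.I) ∂μ := by
        refine integral_congr_ae ?_
        filter_upwards [Lp.coeFn_smul c (h : Lp ℝ 2 μ),
          Lp.coeFn_add (c • (h : Lp ℝ 2 μ)) (g' : Lp ℝ 2 μ)] with x h1 h2
        rw [hg, Submodule.coe_add, Submodule.coe_smul, h2, Pi.add_apply, h1,
          ← Complex.exp_add, ← Complex.exp_add]
        congr 1
        simp
        ring
    _ = _ := by
        rw [hind'.integral_fun_mul_eq_mul_integral (by fun_prop) (by fun_prop), e1, e2,
          ← Complex.exp_add]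
        congr 1
        have n1' : (‖g‖ : ℂ) ^ 2 = c ^ 2 * ‖h‖ ^ 2 + ‖g'‖ ^ 2 := by exact_mod_cast n1
        rw [n1', n2]
        push_cast
        ring_nf
        simp
        ring

lemma CameronMartin.integrable_exp_mul (hmean : ∫ x, x ∂μ = 0) (h : CameronMartin μ) (c : ℝ) :
    Integrable (fun x => Real.exp (c * (h : Lp ℝ 2 μ) x)) μ := by
  have hm : AEMeasurable (h : Lp ℝ 2 μ) μ := (Lp.aestronglyMeasurable _).aemeasurable
  have h1 : Integrable (fun r => Real.exp (c * r)) (μ.map (h : Lp ℝ 2 μ)) := by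
    rw [CameronMartin.map_eq_gaussianReal hmean]
    exact integrable_exp_mul_gaussianReal c
  exact (integrable_map_measure (by fun_prop) hm).1 h1

lemma CameronMartin.integrable_smul_id (h : CameronMartin μ) :
    Integrable (fun x => (h : Lp ℝ 2 μ) x • x) μ :=
  memLp_one_iff_integrable.1
    (MemLp.smul (r := 1) (IsGaussian.memLp_id μ 2 (by norm_num)) (Lp.memLp (h : Lp ℝ 2 μ)))

/-- The functional passes under the Bochner integral: the embedding is adjoint to `StrongDual.toLp`.
Its linearity, boundedness and injectivity all follow from this. -/
lemma CameronMartin.dual_toX (f : StrongDual ℝ X) (h : CameronMartin μ) :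
    f h.toX = inner ℝ (CameronMartin.ofDual μ f) h := by
  rw [CameronMartin.toX, ← f.integral_comp_comm h.integrable_smul_id]
  change _ = inner ℝ (StrongDual.toLp (𝕜 := ℝ) μ 2 f) (h : Lp ℝ 2 μ)
  rw [real_inner_Lp_eq_integral]
  refine integral_congr_ae ?_
  filter_upwards [strongDual_toLp_coeFn (μ := μ) f] with x hx
  rw [hx, map_smul, smul_eq_mul, mul_comm]

variable (μ) in
/-- The embedding of the Cameron-Martin space as a continuous linear map. -/
noncomputable def CameronMartin.toXL : CameronMartin μ →L[ℝ] X :=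
  LinearMap.mkContinuous
    { toFun := CameronMartin.toX
      map_add' := fun g h => by
        refine (SeparatingDual.eq_iff_forall_dual_eq (R := ℝ)).2 fun f => ?_
        rw [map_add, CameronMartin.dual_toX, CameronMartin.dual_toX, CameronMartin.dual_toX,
          inner_add_right]
      map_smul' := fun c h => by
        refine (SeparatingDual.eq_iff_forall_dual_eq (R := ℝ)).2 fun f => ?_
        rw [RingHom.id_apply, map_smul, CameronMartin.dual_toX, CameronMartin.dual_toX,
          inner_smul_right, smul_eq_mul] }
    -- An adjoint satisfies the same norm bound as the original map.
    ‖StrongDual.toLp (𝕜 := ℝ) μ 2‖ (fun h => by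
      refine NormedSpace.norm_le_dual_bound ℝ _ (by positivity) fun f => ?_
      change ‖f h.toX‖ ≤ _
      rw [CameronMartin.dual_toX]
      refine (norm_inner_le_norm _ _).trans ?_
      have : ‖CameronMartin.ofDual μ f‖ ≤ ‖StrongDual.toLp (𝕜 := ℝ) μ 2‖ * ‖f‖ :=
        (StrongDual.toLp (𝕜 := ℝ) μ 2).le_opNorm f
      calc _ ≤ ‖StrongDual.toLp (𝕜 := ℝ) μ 2‖ * ‖f‖ * ‖h‖ := by gcongr
        _ = _ := by ring)

lemma CameronMartin.toXL_apply (h : CameronMartin μ) : CameronMartin.toXL μ h = h.toX := rfl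

lemma CameronMartin.toX_smul (c : ℝ) (h : CameronMartin μ) : (c • h).toX = c • h.toX :=
  (CameronMartin.toXL μ).map_smul c h

/-- The Cameron-Martin theorem. -/
theorem CameronMartin.map_add_toX (hmean : ∫ x, x ∂μ = 0) (h : CameronMartin μ) :
    μ.map (fun x => x + h.toX)
      = μ.withDensity fun x => ENNReal.ofReal (Real.exp ((h : Lp ℝ 2 μ) x - ‖h‖ ^ 2 / 2)) := by
  have hm : AEMeasurable (h : Lp ℝ 2 μ) μ := (Lp.aestronglyMeasurable _).aemeasurable
  have hint : Integrable (fun x => Real.exp ((h : Lp ℝ 2 μ) x - ‖h‖ ^ 2 / 2)) μ := by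
    have := (h.integrable_exp_mul hmean 1).mul_const (Real.exp (-(‖h‖ ^ 2 / 2)))
    simpa [← Real.exp_add, sub_eq_add_neg] using this
  have := isFiniteMeasure_withDensity_ofReal hint.2
  -- Translation multiplies the characteristic function at `f` by `exp (i f(h))`; this is the cross
  -- term `⟨f, h⟩_E` in the transform of the tilted measure.
  refine Measure.ext_of_charFunDual ?_
  ext f
  rw [charFunDual_map_add_const, charFunDual_apply, charFunDual_apply,
    integral_withDensity_eq_integral_toReal_smul₀ (by fun_prop) (by simp)]
  have key := CameronMartin.integral_cexp_mul_exp hmean (CameronMartin.ofDual μ f) h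
  have key0 := CameronMartin.integral_cexp hmean (CameronMartin.ofDual μ f)
  have hf : ∀ᵐ x ∂μ, ((CameronMartin.ofDual μ f : Lp ℝ 2 μ)) x = f x := strongDual_toLp_coeFn f
  have e0 : ∫ x, Complex.exp (f x * Complex.I) ∂μ
      = Complex.exp (-(‖CameronMartin.ofDual μ f‖ : ℂ) ^ 2 / 2) := by
    rw [← key0]
    refine integral_congr_ae ?_
    filter_upwards [hf] with x hx
    rw [hx]
  have e1 : ∫ x, (ENNReal.ofReal (Real.exp ((h : Lp ℝ 2 μ) x - ‖h‖ ^ 2 / 2))).toReal •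
        Complex.exp (f x * Complex.I) ∂μ
      = Complex.exp (-(‖h‖ : ℂ) ^ 2 / 2) * ∫ x, Complex.exp ((CameronMartin.ofDual μ f : Lp ℝ 2 μ) x
          * Complex.I) * Complex.exp ((h : Lp ℝ 2 μ) x) ∂μ := by
    rw [← integral_const_mul]
    refine integral_congr_ae ?_
    filter_upwards [hf] with x hx
    rw [hx, ENNReal.toReal_ofReal (Real.exp_pos _).le, Complex.real_smul, Complex.ofReal_exp,
      ← Complex.exp_add, ← Complex.exp_add, ← Complex.exp_add]
    congr 1
    push_cast
    ring
  rw [e0, e1, key, CameronMartin.dual_toX, ← Complex.exp_add, ← Complex.exp_add]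
  congr 1
  ring

/-- Convergence in `L²` implies convergence in measure, hence almost everywhere along a subsequence.
-/
lemma CameronMartin.exists_seq_dual (h : CameronMartin μ) :
    ∃ f : ℕ → StrongDual ℝ X, Tendsto (fun n => CameronMartin.ofDual μ (f n)) atTop (𝓝 h) ∧
      ∀ᵐ x ∂μ, Tendsto (fun n => f n x) atTop (𝓝 ((h : Lp ℝ 2 μ) x)) := by
  obtain ⟨w, hw, hwt⟩ := mem_closure_iff_seq_limit.1
    (show (h : Lp ℝ 2 μ) ∈ closure _ from h.2)
  choose f hf using hw
  obtain ⟨ns, hns, hae⟩ := (tendstoInMeasure_of_tendsto_Lp hwt).exists_seq_tendsto_ae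
  refine ⟨fun n => f (ns n), ?_, ?_⟩
  · rw [tendsto_subtype_rng]
    refine (hwt.comp hns.tendsto_atTop).congr fun n => (hf (ns n)).symm
  · have : ∀ᵐ x ∂μ, ∀ n, w n x = f n x := ae_all_iff.2 fun n => by
      have := strongDual_toLp_coeFn (μ := μ) (f n)
      rw [← hf n]
      exact this
    filter_upwards [hae, this] with x h1 h2
    simpa [h2] using h1

/-- The points where the approximating functionals converge form a subspace of full measure. The
limit is linear there and extends algebraically to `X`. -/
lemma exists_isPairingVersion (h : CameronMartin μ) : ∃ ℓ : X →ₗ[ℝ] ℝ, IsPairingVersion μ h ℓ := by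
  obtain ⟨f, -, hf⟩ := h.exists_seq_dual
  let C : Submodule ℝ X :=
    { carrier := {x | ∃ l, Tendsto (fun n => f n x) atTop (𝓝 l)}
      add_mem' := by
        rintro x y ⟨l, hl⟩ ⟨m, hm⟩
        exact ⟨l + m, by simpa using hl.add hm⟩
      zero_mem' := ⟨0, by simp⟩
      smul_mem' := by
        rintro c x ⟨l, hl⟩
        exact ⟨c * l, by simpa using hl.const_mul c⟩ }
  have hC : ∀ x : C, ∃ l, Tendsto (fun n => f n x) atTop (𝓝 l) := fun x => x.2
  choose L hL using hC
  let L' : C →ₗ[ℝ] ℝ :=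
    { toFun := L
      map_add' := fun x y => tendsto_nhds_unique (hL _) (by simpa using (hL x).add (hL y))
      map_smul' := fun c x => tendsto_nhds_unique (hL _) (by simpa using (hL x).const_mul c) }
  obtain ⟨ℓ, hℓ⟩ := L'.exists_extend
  refine ⟨ℓ, ?_⟩
  filter_upwards [hf] with x hx
  have : ℓ x = L ⟨x, _, hx⟩ := LinearMap.congr_fun hℓ ⟨x, _, hx⟩
  rw [this]
  exact tendsto_nhds_unique (hL _) hx

/-- A version of `⟨·, h⟩_E` coincides with the inner product on the Cameron-Martin space. -/
lemma IsPairingVersion.apply_toX (hmean : ∫ x, x ∂μ = 0) {h : CameronMartin μ} {ℓ : X →ₗ[ℝ] ℝ}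
    (hℓ : IsPairingVersion μ h ℓ) (u : CameronMartin μ) : ℓ u.toX = inner ℝ u h := by
  obtain ⟨f, hf, hae⟩ := h.exists_seq_dual
  have h1 : ∀ᵐ x ∂μ, Tendsto (fun n => f n x) atTop (𝓝 (ℓ x)) := by
    filter_upwards [hae, hℓ] with x hx hx'
    rwa [hx']
  -- The law of `x + u` is absolutely continuous, so convergence also holds at almost every
  -- translated point; subtracting at a common `x` leaves convergence at `u` itself.
  have h2 : ∀ᵐ x ∂μ, Tendsto (fun n => f n (x + u.toX)) atTop (𝓝 (ℓ (x + u.toX))) := by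
    refine ae_of_ae_map (μ := μ) (f := fun x => x + u.toX)
      (p := fun y => Tendsto (fun n => f n y) atTop (𝓝 (ℓ y))) (by fun_prop) ?_
    rw [CameronMartin.map_add_toX hmean]
    exact (withDensity_absolutelyContinuous _ _).ae_le h1
  obtain ⟨x, hx1, hx2⟩ := (h1.and h2).exists
  have l1 : Tendsto (fun n => f n u.toX) atTop (𝓝 (ℓ u.toX)) := by
    simpa using hx2.sub hx1
  have l2 : Tendsto (fun n => f n u.toX) atTop (𝓝 (inner ℝ u h)) := by
    simp_rw [CameronMartin.dual_toX, real_inner_comm u]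
    exact tendsto_const_nhds.inner hf
  exact tendsto_nhds_unique l1 l2

/-- Continuous functionals are dense in `E`, so a difference that they all annihilate is orthogonal
to `E`. -/
lemma CameronMartin.toX_injective : Function.Injective (CameronMartin.toX (μ := μ)) := by
  intro u v huv
  have h0 : ∀ h : CameronMartin μ, inner ℝ h (u - v) = 0 := by
    intro h
    obtain ⟨f, hf, -⟩ := h.exists_seq_dual
    refine tendsto_nhds_unique (hf.inner tendsto_const_nhds) ?_
    simp only [inner_sub_right, ← CameronMartin.dual_toX, huv, sub_self]
    exact tendsto_const_nhds
  exact sub_eq_zero.1 (inner_self_eq_zero (𝕜 := ℝ) |>.1 (h0 (u - v)))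

end CameronMartinTheory

/-! ### Lipschitz bounds and other one-variable estimates -/

/-- A `C¹` function on a compact set has bounded derivative on the interior. -/
lemma IsCompact.exists_bound_fderiv_interior {F : Type*} [NormedAddCommGroup F] [NormedSpace ℝ F]
    {S : Set F} (hS : IsCompact S) {ρ : F → ℝ} (hρ : ContDiffOn ℝ 1 ρ S) :
    ∃ C : ℝ, ∀ a ∈ interior S, ‖fderiv ℝ ρ a‖ ≤ C := by
  suffices h : ∃ C : ℝ, ∀ a ∈ interior S ∩ S, ‖fderiv ℝ ρ a‖ ≤ C by
    obtain ⟨C, hC⟩ := h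
    exact ⟨C, fun a ha => hC a ⟨ha, interior_subset ha⟩⟩
  refine hS.induction_on (p := fun T => ∃ C : ℝ, ∀ a ∈ interior S ∩ T, ‖fderiv ℝ ρ a‖ ≤ C)
    ⟨0, by simp⟩ ?_ ?_ ?_
  · rintro s t hst ⟨C, hC⟩
    exact ⟨C, fun a ha => hC a ⟨ha.1, hst ha.2⟩⟩
  · rintro s t ⟨C, hC⟩ ⟨D, hD⟩
    refine ⟨max C D, ?_⟩
    rintro a ⟨ha, has | hat⟩
    · exact (hC a ⟨ha, has⟩).trans (le_max_left _ _)
    · exact (hD a ⟨ha, hat⟩).trans (le_max_right _ _)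
  · intro x hx
    have h1 : ContDiffWithinAt ℝ (0 + 1) ρ S x := by simpa using hρ x hx
    -- Derivatives within `S` need not be unique, so a local choice `f'`, continuous at `x`, is
    -- used; at interior points it is forced to be `fderiv ℝ ρ`.
    obtain ⟨u, hu, -, f', hf', hcont⟩ := (contDiffWithinAt_succ_iff_hasFDerivWithinAt (by simp)).1 h1
    rw [insert_eq_of_mem hx] at hu
    have hb : ∀ᶠ y in 𝓝[u] x, ‖f' y‖ < ‖f' x‖ + 1 :=
      hcont.continuousWithinAt.norm.eventually (gt_mem_nhds (lt_add_one _))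
    obtain ⟨V, hV, hxV, hVu⟩ := mem_nhdsWithin.1 hu
    obtain ⟨W, hW, hxW, hWu⟩ := mem_nhdsWithin.1 hb
    refine ⟨S ∩ (V ∩ W), inter_mem_nhdsWithin _ ((hV.inter hW).mem_nhds ⟨hxV, hxW⟩),
      ‖f' x‖ + 1, ?_⟩
    rintro a ⟨ha, haS, haV, haW⟩
    have hau : u ∈ 𝓝 a := by
      filter_upwards [hV.mem_nhds haV, mem_interior_iff_mem_nhds.1 ha] with y h1 h2
      exact hVu ⟨h1, h2⟩
    have hder := (hf' a (hVu ⟨haV, haS⟩)).hasFDerivAt hau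
    rw [hder.fderiv]
    exact (hWu ⟨haW, hVu ⟨haV, haS⟩⟩ : ‖f' a‖ < _).le

/-- A continuous function that vanishes off an open set and has bounded derivative on it is
Lipschitz. -/
lemma abs_sub_le_of_hasDerivAt_of_eq_zero {g g' : ℝ → ℝ} {U : Set ℝ} {L : ℝ} (hU : IsOpen U)
    (hg : Continuous g) (h0 : ∀ t ∉ U, g t = 0) (hd : ∀ t ∈ U, HasDerivAt g (g' t) t)
    (hL : ∀ t ∈ U, |g' t| ≤ L) (hL0 : 0 ≤ L) (s t : ℝ) : |g t - g s| ≤ L * |t - s| := by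
  have mvt : ∀ s t, s ≤ t → Ioo s t ⊆ U → |g t - g s| ≤ L * (t - s) := by
    intro s t hst hsub
    rcases hst.eq_or_lt with rfl | hst
    · simp
    obtain ⟨c, hc, hc'⟩ := exists_hasDerivAt_eq_slope g g' hst hg.continuousOn
      (fun x hx => hd x (hsub hx))
    have hpos : 0 < t - s := sub_pos.2 hst
    have := hL c (hsub hc)
    rwa [hc', abs_div, abs_of_pos hpos, div_le_iff₀ hpos] at this
  wlog hst : s ≤ t generalizing s t
  · rw [abs_sub_comm, abs_sub_comm t s]
    exact this t s (le_of_not_ge hst)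
  rw [abs_of_nonneg (sub_nonneg.2 hst)]
  -- Let `p` and `q` be the first and last points of `[s, t]` outside `U`. As `g` vanishes at both,
  -- the mean value theorem is needed only on `[s, p]` and `[q, t]`.
  have hcomp : IsCompact (Icc s t \ U) := isCompact_Icc.diff hU
  rcases (Icc s t \ U).eq_empty_or_nonempty with he | hne
  · exact mvt s t hst fun x hx => by
      by_contra hxU
      have : x ∈ Icc s t \ U := ⟨Ioo_subset_Icc_self hx, hxU⟩
      simp [he] at this
  obtain ⟨p, hp, hpl⟩ := hcomp.exists_isLeast hne
  obtain ⟨q, hq, hqg⟩ := hcomp.exists_isGreatest hne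
  have h1 := mvt s p hp.1.1 fun x hx => by
    by_contra hxU
    exact absurd (hpl ⟨⟨hx.1.le, hx.2.le.trans hp.1.2⟩, hxU⟩) (not_le.2 hx.2)
  have h2 := mvt q t hq.1.2 fun x hx => by
    by_contra hxU
    exact absurd (hqg ⟨⟨hq.1.1.trans hx.1.le, hx.2.le⟩, hxU⟩) (not_le.2 hx.1)
  have hpq : p ≤ q := hpl hq
  rw [h0 p hp.2, zero_sub, abs_neg] at h1
  rw [h0 q hq.2, sub_zero] at h2
  calc |g t - g s| ≤ |g t| + |g s| := abs_sub _ _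
    _ ≤ L * (t - q) + L * (p - s) := add_le_add h2 h1
    _ ≤ L * (t - s) := by nlinarith

/-- A continuous function vanishing off an open set, with bounded derivative on it,
is Lipschitz. -/
lemma lipschitzWith_of_fderiv_bound_of_eq_zero {F : Type*} [NormedAddCommGroup F] [NormedSpace ℝ F]
    {U : Set F} {ρ : F → ℝ} {C : NNReal} (hU : IsOpen U) (hρ : Continuous ρ)
    (h0 : ∀ a ∉ U, ρ a = 0) (hd : ∀ a ∈ U, DifferentiableAt ℝ ρ a)
    (hC : ∀ a ∈ U, ‖fderiv ℝ ρ a‖ ≤ C) : LipschitzWith C ρ := by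
  refine LipschitzWith.of_dist_le_mul fun y x => ?_
  have hl : Continuous fun t : ℝ => x + t • (y - x) := by fun_prop
  have key := abs_sub_le_of_hasDerivAt_of_eq_zero (g := fun t : ℝ => ρ (x + t • (y - x)))
    (g' := fun t => fderiv ℝ ρ (x + t • (y - x)) (y - x)) (L := C * ‖y - x‖)
    (hU.preimage hl) (hρ.comp hl) (fun t ht => h0 _ ht)
    (fun t ht => by
      have h1 : HasDerivAt (fun t : ℝ => x + t • (y - x)) (y - x) t := by
        simpa using ((hasDerivAt_id t).smul_const (y - x)).const_add x
      exact (hd _ ht).hasFDerivAt.comp_hasDerivAt t h1)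
    (fun t ht => ((fderiv ℝ ρ _).le_opNorm _).trans
      (mul_le_mul_of_nonneg_right (hC _ ht) (norm_nonneg _)))
    (by positivity) 0 1
  simpa [dist_eq_norm] using key

/-- A nonnegative function on a finite-dimensional space that is Lipschitz has derivative zero at
almost all of its zeros. -/
lemma LipschitzWith.ae_hasFDerivAt_zero_of_nonneg {F : Type*} [NormedAddCommGroup F]
    [NormedSpace ℝ F] [FiniteDimensional ℝ F] [MeasurableSpace F] [BorelSpace F] (m : Measure F)
    [m.IsAddHaarMeasure] {ρ : F → ℝ} {C : NNReal} (hρ : LipschitzWith C ρ) (h0 : ∀ a, 0 ≤ ρ a) :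
    ∀ᵐ a ∂m, ρ a = 0 → HasFDerivAt ρ (0 : F →L[ℝ] ℝ) a := by
  -- Rademacher's theorem; a zero of a nonnegative function is a minimum, so its derivative
  -- vanishes.
  filter_upwards [hρ.ae_differentiableAt (μ := m)] with a ha h
  have hmin : IsLocalMin ρ a := Eventually.of_forall fun b => by rw [h]; exact h0 b
  rw [← hmin.fderiv_eq_zero]
  exact ha.hasFDerivAt

/-- `t ↦ exp (-t x - t² n / 2)` is Lipschitz on `[-1, 1]`. -/
lemma abs_exp_neg_mul_sub_le (x : ℝ) {n s t : ℝ} (hn : 0 ≤ n) (hs : |s| ≤ 1) (ht : |t| ≤ 1) :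
    |Real.exp (-t * x - t ^ 2 * n / 2) - Real.exp (-s * x - s ^ 2 * n / 2)|
      ≤ (|x| + n) * Real.exp |x| * |t - s| := by
  have hd : ∀ r ∈ Icc (-1 : ℝ) 1, HasDerivWithinAt (fun t => Real.exp (-t * x - t ^ 2 * n / 2))
      (Real.exp (-r * x - r ^ 2 * n / 2) * (-x - r * n)) (Icc (-1) 1) r := by
    intro r _
    have h1 : HasDerivAt (fun t : ℝ => -t * x - t ^ 2 * n / 2) (-x - r * n) r := by
      have := ((hasDerivAt_id r).neg.mul_const x).sub (((hasDerivAt_pow 2 r).mul_const n).div_const 2)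
      refine this.congr_deriv ?_
      simp only [Nat.cast_ofNat]
      ring
    exact h1.exp.hasDerivWithinAt
  refine (convex_Icc (-1 : ℝ) 1).norm_image_sub_le_of_norm_hasDerivWithin_le hd ?_
    (abs_le.1 hs) (abs_le.1 ht)
  intro r hr
  have hr' : |r| ≤ 1 := abs_le.2 hr
  rw [norm_mul, Real.norm_eq_abs, Real.norm_eq_abs, Real.abs_exp, mul_comm]
  have hrx : |r * x| ≤ |x| := by
    rw [abs_mul]
    exact mul_le_of_le_one_left (abs_nonneg x) hr'
  have hrn : |r * n| ≤ n := by
    rw [abs_mul, abs_of_nonneg hn]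
    exact mul_le_of_le_one_left hn hr'
  gcongr
  · calc |-x - r * n| ≤ |-x| + |r * n| := abs_sub _ _
      _ ≤ |x| + n := by rw [abs_neg]; gcongr
  · have := neg_le_of_abs_le hrx
    have : 0 ≤ r ^ 2 * n / 2 := by positivity
    linarith

lemma exp_neg_mul_sub_le (x : ℝ) {n t : ℝ} (hn : 0 ≤ n) (ht : |t| ≤ 1) :
    Real.exp (-t * x - t ^ 2 * n / 2) ≤ Real.exp |x| := by
  have hrx : |t * x| ≤ |x| := by
    rw [abs_mul]
    exact mul_le_of_le_one_left (abs_nonneg x) ht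
  have := neg_le_of_abs_le hrx
  have : 0 ≤ t ^ 2 * n / 2 := by positivity
  gcongr
  linarith

/-- The derivative is a limit of difference quotients, so its measurability need not be assumed. -/
lemma aestronglyMeasurable_of_hasDerivAt {α : Type*} [MeasurableSpace α] {m : Measure α}
    {F : ℝ → α → ℝ} {F' : α → ℝ} (hF : ∀ t, AEStronglyMeasurable (F t) m)
    (hd : ∀ᵐ p ∂m, HasDerivAt (F · p) (F' p) 0) : AEStronglyMeasurable F' m := by
  refine aestronglyMeasurable_of_tendsto_ae (𝓝[≠] (0 : ℝ))
    (f := fun t p => t⁻¹ • (F (0 + t) p - F 0 p)) (fun t => ((hF (0 + t)).sub (hF 0)).const_smul t⁻¹) ?_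
  filter_upwards [hd] with p hp
  exact hasDerivAt_iff_tendsto_slope_zero.1 hp

/-! ### Translating the product measure -/

section Translation

variable {X : Type*} [NormedAddCommGroup X] [NormedSpace ℝ X] [MeasurableSpace X] [BorelSpace X]
  [CompleteSpace X] [SecondCountableTopology X] {μ : Measure X} [IsGaussian μ]
  {F : Type*} [NormedAddCommGroup F] [MeasurableSpace F] [BorelSpace F]
  {ν : Measure F} [SFinite ν] [ν.IsAddRightInvariant]

/-- Translation of `μ ⊗ ν` along a vector of the Cameron-Martin space times an arbitrary vector. -/
lemma CameronMartin.prod_map_add (hmean : ∫ x, x ∂μ = 0) (h : CameronMartin μ) (b : F) :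
    (μ.prod ν).map (fun p => p + (h.toX, b)) = (μ.prod ν).withDensity
      fun p => ENNReal.ofReal (Real.exp ((h : Lp ℝ 2 μ) p.1 - ‖h‖ ^ 2 / 2)) := by
  have hm : AEMeasurable (h : Lp ℝ 2 μ) μ := (Lp.aestronglyMeasurable _).aemeasurable
  have e := Measure.map_prod_map μ ν (f := fun x => x + h.toX) (g := fun a => a + b)
    (by fun_prop) (by fun_prop)
  rw [map_add_right_eq_self ν b, CameronMartin.map_add_toX hmean,
    prod_withDensity_left₀ (by fun_prop)] at e
  exact e.symm

variable [NormedSpace ℝ F] [SecondCountableTopology F]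

/-- Substitute `p ↦ p - t z` and apply the Cameron-Martin formula to `-t • h`. The domain no longer
depends on `t`. -/
lemma CameronMartin.setIntegral_image_add (hmean : ∫ x, x ∂μ = 0) (h : CameronMartin μ) (b : F)
    (t : ℝ) (G : X × F → ℝ) {A : Set (X × F)} (hA : MeasurableSet A) :
    ∫ p in (fun p => p + t • (h.toX, b)) '' A, G p ∂(μ.prod ν) =
      ∫ p in A, G (p + t • (h.toX, b)) *
        Real.exp (-t * (h : Lp ℝ 2 μ) p.1 - t ^ 2 * ‖h‖ ^ 2 / 2) ∂(μ.prod ν) := by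
  have hm : AEMeasurable (h : Lp ℝ 2 μ) μ := (Lp.aestronglyMeasurable _).aemeasurable
  set z : X × F := t • (h.toX, b) with hz
  have hzn : (((-t) • h).toX, (-t) • b) = -z := by
    rw [CameronMartin.toX_smul, hz]; simp
  have key := CameronMartin.prod_map_add (ν := ν) hmean ((-t) • h) ((-t) • b)
  rw [hzn] at key
  have himg : (fun p => p + z) '' A = (fun p => p + -z) ⁻¹' A := by
    ext p
    simp only [mem_image, mem_preimage]
    exact ⟨by rintro ⟨q, hq, rfl⟩; simpa using hq, fun hp => ⟨_, hp, by simp⟩⟩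
  have hA' : MeasurableSet ((fun p => p + z) '' A) := by
    rw [himg]
    exact (by fun_prop : Measurable fun p : X × F => p + -z) hA
  have hemb : MeasurableEmbedding (fun p : X × F => p + -z) :=
    (MeasurableEquiv.addRight (-z)).measurableEmbedding
  have hw : AEMeasurable (fun p : X × F => ENNReal.ofReal
      (Real.exp ((((-t) • h : CameronMartin μ) : Lp ℝ 2 μ) p.1 - ‖(-t) • h‖ ^ 2 / 2)))
      (μ.prod ν) := by
    have : AEMeasurable (fun p : X × F => (((-t) • h : CameronMartin μ) : Lp ℝ 2 μ) p.1)
      (μ.prod ν) := ((Lp.aestronglyMeasurable _).comp_fst).aemeasurable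
    fun_prop
  have hsm : ∀ᵐ p ∂(μ.prod ν), (((-t) • h : CameronMartin μ) : Lp ℝ 2 μ) p.1
      = -t * (h : Lp ℝ 2 μ) p.1 :=
    Measure.quasiMeasurePreserving_fst.ae (Lp.coeFn_smul (-t) (h : Lp ℝ 2 μ))
  calc ∫ p in (fun p => p + z) '' A, G p ∂(μ.prod ν)
      = ∫ p in (fun p => p + -z) ⁻¹' A, G ((p + -z) + z) ∂(μ.prod ν) := by
        rw [himg]; simp
    _ = ∫ p in A, G (p + z) ∂((μ.prod ν).map (fun p => p + -z)) := by
        rw [hemb.setIntegral_map]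
    _ = _ := by
        rw [key, restrict_withDensity hA, integral_withDensity_eq_integral_toReal_smul₀ hw.restrict
          (by simp)]
        refine integral_congr_ae ?_
        filter_upwards [ae_restrict_of_ae hsm] with p hp
        rw [ENNReal.toReal_ofReal (Real.exp_pos _).le, hp, norm_smul, smul_eq_mul, mul_comm,
          mul_pow, Real.norm_eq_abs, sq_abs]
        ring_nf

end Translation

/-! ### Differentiation under the integral sign -/

section Derivative

variable {X : Type*} [NormedAddCommGroup X] [NormedSpace ℝ X] [MeasurableSpace X] [BorelSpace X]
  [CompleteSpace X] [SecondCountableTopology X] {μ : Measure X} [IsGaussian μ]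
  {F : Type*} [NormedAddCommGroup F] [MeasurableSpace F] [BorelSpace F]
  {ν : Measure F} [IsFiniteMeasureOnCompacts ν]

lemma CameronMartin.integrable_prod_indicator_mul_exp (hmean : ∫ x, x ∂μ = 0) (h : CameronMartin μ)
    {K : Set F} (hK : IsCompact K) (c : ℝ) :
    Integrable (fun p : X × F => c * (Real.exp (2 * (h : Lp ℝ 2 μ) p.1)
      + Real.exp (-2 * (h : Lp ℝ 2 μ) p.1)) * K.indicator (fun _ => (1 : ℝ)) p.2) (μ.prod ν) := by
  have h1 : Integrable (fun x => c * (Real.exp (2 * (h : Lp ℝ 2 μ) x)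
      + Real.exp (-2 * (h : Lp ℝ 2 μ) x))) μ :=
    ((h.integrable_exp_mul hmean 2).add (h.integrable_exp_mul hmean (-2))).const_mul c
  have h2 : Integrable (K.indicator fun _ => (1 : ℝ)) ν :=
    (integrable_indicator_iff hK.measurableSet).2 (integrableOn_const hK.measure_lt_top.ne)
  exact h1.mul_prod h2

/-- The factor `|x|` is absorbed into a second `exp |x|`, and `exp (2|x|) ≤ exp (2x) + exp (-2x)`
has the form covered by Gaussian exponential moments. -/
lemma add_mul_exp_abs_le {L B n x : ℝ} (hL : 0 ≤ L) (hB : 0 ≤ B) (hn : 0 ≤ n) :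
    L * Real.exp |x| + B * ((|x| + n) * Real.exp |x|) ≤
      (L + B + B * n) * (Real.exp (2 * x) + Real.exp (-2 * x)) := by
  have h1 : 1 ≤ Real.exp |x| := Real.one_le_exp (abs_nonneg x)
  have h2 : |x| ≤ Real.exp |x| := by linarith [Real.add_one_le_exp |x|]
  have h3 : Real.exp |x| * Real.exp |x| ≤ Real.exp (2 * x) + Real.exp (-2 * x) := by
    rw [← Real.exp_add]
    rcases abs_cases x with ⟨e, _⟩ | ⟨e, _⟩ <;> rw [e]
    · have : x + x = 2 * x := by ring
      rw [this]
      linarith [Real.exp_pos (-2 * x)]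
    · have : -x + -x = -2 * x := by ring
      rw [this]
      linarith [Real.exp_pos (2 * x)]
  set E := Real.exp |x|
  have hE : E ≤ E * E := by nlinarith
  calc L * E + B * ((|x| + n) * E) = L * E + B * (|x| * E) + B * n * E := by ring
    _ ≤ L * (E * E) + B * (E * E) + B * n * (E * E) := by gcongr
    _ = (L + B + B * n) * (E * E) := by ring
    _ ≤ _ := by gcongr

variable [NormedSpace ℝ F] [SecondCountableTopology F] [SFinite ν] [ν.IsAddRightInvariant]

/-- Differentiation of `t ↦ ∫_{A + t (h, b)} G d(μ ⊗ ν)` at `t = 0`. -/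
theorem CameronMartin.hasDerivAt_setIntegral_image_add (hmean : ∫ x, x ∂μ = 0)
    (h : CameronMartin μ) (b : F) {G D : X × F → ℝ} {S : Set F} (hS : IsCompact S)
    (hGm : Measurable G) {B : ℝ} (hGB : ∀ p, |G p| ≤ B) (hGS : ∀ p, p.2 ∉ S → G p = 0)
    {A : Set (X × F)} (hA : MeasurableSet A) {ε L : ℝ} (hε : 0 < ε) (hL : 0 ≤ L)
    (hlip : ∀ p ∈ A, ∀ s t : ℝ, |s| < ε → |t| < ε →
      |G (p + t • (h.toX, b)) - G (p + s • (h.toX, b))| ≤ L * |t - s|)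
    (hder : ∀ᵐ p ∂(μ.prod ν), p ∈ A →
      HasDerivAt (fun t : ℝ => G (p + t • (h.toX, b))) (D p) 0) :
    IntegrableOn (fun p => D p - (h : Lp ℝ 2 μ) p.1 * G p) A (μ.prod ν) ∧
    HasDerivAt (fun t : ℝ => ∫ p in (fun p => p + t • (h.toX, b)) '' A, G p ∂(μ.prod ν))
      (∫ p in A, (D p - (h : Lp ℝ 2 μ) p.1 * G p) ∂(μ.prod ν)) 0 := by
  simp_rw [h.setIntegral_image_add hmean b _ G hA]
  set n : ℝ := ‖h‖ ^ 2 with hn_def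
  have hn : 0 ≤ n := by positivity
  have hB : 0 ≤ B := (abs_nonneg _).trans (hGB 0)
  -- The parameters that some `t b` with `|t| ≤ 1` carries into `S`. Off this compact set the
  -- integrand vanishes for all such `t`.
  set K : Set F := (fun q : F × ℝ => q.1 - q.2 • b) '' (S ×ˢ Icc (-1) 1)
  have hK : IsCompact K := (hS.prod isCompact_Icc).image (by fun_prop)
  have hout : ∀ p : X × F, p.2 ∉ K → ∀ t : ℝ, |t| ≤ 1 → G (p + t • (h.toX, b)) = 0 := by
    intro p hp t ht
    refine hGS _ fun hmem => hp ⟨((p + t • (h.toX, b)).2, t), ⟨hmem, abs_le.1 ht⟩, ?_⟩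
    simp
  have hhm : AEMeasurable (fun p : X × F => (h : Lp ℝ 2 μ) p.1) (μ.prod ν) :=
    ((Lp.aestronglyMeasurable _).comp_fst).aemeasurable
  set W : ℝ → X × F → ℝ := fun t p => G (p + t • (h.toX, b)) *
        Real.exp (-t * (h : Lp ℝ 2 μ) p.1 - t ^ 2 * n / 2) with hW
  have hWm : ∀ t, AEStronglyMeasurable (W t) ((μ.prod ν).restrict A) := by
    intro t
    refine AEMeasurable.aestronglyMeasurable (AEMeasurable.restrict ?_)
    have h1 : Measurable fun p : X × F => G (p + t • (h.toX, b)) := hGm.comp (by fun_prop)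
    exact h1.aemeasurable.mul (by fun_prop)
  have hWd : ∀ᵐ p ∂((μ.prod ν).restrict A),
      HasDerivAt (W · p) (D p - (h : Lp ℝ 2 μ) p.1 * G p) 0 := by
    filter_upwards [ae_restrict_of_ae hder, ae_restrict_mem hA] with p hp hpA
    have h1 : HasDerivAt (fun t : ℝ => -t * (h : Lp ℝ 2 μ) p.1 - t ^ 2 * n / 2)
        (-(h : Lp ℝ 2 μ) p.1) 0 := by
      have := ((hasDerivAt_id (0 : ℝ)).neg.mul_const ((h : Lp ℝ 2 μ) p.1)).sub
        (((hasDerivAt_pow 2 (0 : ℝ)).mul_const n).div_const 2)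
      refine this.congr_deriv ?_
      simp
    refine ((hp hpA).mul h1.exp).congr_deriv ?_
    simp
    ring
  set bound : X × F → ℝ := fun p => (L + B + B * n) * (Real.exp (2 * (h : Lp ℝ 2 μ) p.1)
      + Real.exp (-2 * (h : Lp ℝ 2 μ) p.1)) * K.indicator (fun _ => (1 : ℝ)) p.2 with hbd
  have hbound : Integrable bound (μ.prod ν) :=
    h.integrable_prod_indicator_mul_exp hmean hK (L + B + B * n)
  have hbound0 : ∀ p, 0 ≤ bound p := fun p =>
    mul_nonneg (by positivity) (indicator_nonneg (fun _ _ => zero_le_one) _)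
  have hW0 : Integrable (W 0) ((μ.prod ν).restrict A) := by
    have h0 : Integrable (fun p : X × F => B * K.indicator (fun _ => (1 : ℝ)) p.2) (μ.prod ν) :=
      (integrable_const B).mul_prod
        ((integrable_indicator_iff hK.measurableSet).2 (integrableOn_const hK.measure_lt_top.ne))
    refine h0.integrableOn.mono' (hWm 0) (ae_of_all _ fun p => ?_)
    simp only [hW, zero_smul, add_zero]
    by_cases hp : p.2 ∈ K
    · simpa [hp] using hGB p
    · have := hout p hp 0 (by simp)
      rw [zero_smul, add_zero] at this
      simp [hp, this]
  -- This form of dominated differentiation asks for differentiability only at `t = 0`, almost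
  -- everywhere, and so allows lines that cross the boundary of `S`.
  refine hasDerivAt_integral_of_dominated_loc_of_lip (bound := bound)
    (s := Ioo (-min ε 1) (min ε 1)) (Ioo_mem_nhds (by simp [hε]) (by simp [hε]))
    (Eventually.of_forall hWm) hW0 (aestronglyMeasurable_of_hasDerivAt hWm hWd) ?_
    hbound.integrableOn hWd
  filter_upwards [ae_restrict_mem hA] with p hpA
  refine LipschitzOnWith.of_dist_le_mul fun t ht s hs => ?_
  have ht' : |t| < min ε 1 := abs_lt.2 ht
  have hs' : |s| < min ε 1 := abs_lt.2 hs
  have ht1 : |t| ≤ 1 := (ht'.trans_le (min_le_right _ _)).le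
  have hs1 : |s| ≤ 1 := (hs'.trans_le (min_le_right _ _)).le
  rw [Real.coe_nnabs, abs_of_nonneg (hbound0 p), Real.dist_eq, Real.dist_eq]
  by_cases hp : p.2 ∈ K
  · simp only [hbd, indicator_of_mem hp, mul_one]
    set x := (h : Lp ℝ 2 μ) p.1
    have i1 := hlip p hpA s t (hs'.trans_le (min_le_left _ _)) (ht'.trans_le (min_le_left _ _))
    have i2 := abs_exp_neg_mul_sub_le x hn hs1 ht1
    have i3 := exp_neg_mul_sub_le x hn ht1
    set gt := G (p + t • (h.toX, b))
    set gs := G (p + s • (h.toX, b))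
    have i4 : |gs| ≤ B := hGB _
    set wt := Real.exp (-t * x - t ^ 2 * n / 2)
    set ws := Real.exp (-s * x - s ^ 2 * n / 2)
    have hwt : 0 ≤ wt := (Real.exp_pos _).le
    calc |gt * wt - gs * ws| = |(gt - gs) * wt + gs * (wt - ws)| := by ring_nf
      _ ≤ |gt - gs| * wt + |gs| * |wt - ws| := by
        refine (abs_add_le _ _).trans ?_
        rw [abs_mul, abs_mul, abs_of_nonneg hwt]
      _ ≤ (L * |t - s|) * Real.exp |x| + B * ((|x| + n) * Real.exp |x| * |t - s|) := by gcongr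
      _ = (L * Real.exp |x| + B * ((|x| + n) * Real.exp |x|)) * |t - s| := by ring
      _ ≤ _ := by
        gcongr
        exact add_mul_exp_abs_le hL hB hn
  · simp only [hout p hp t ht1, hout p hp s hs1, zero_mul, sub_self, abs_zero]
    exact mul_nonneg (hbound0 p) (abs_nonneg _)

end Derivative

/-! ### The unnormalised density along a line -/

section LineDerivative

variable {X F : Type*} [NormedAddCommGroup X] [NormedSpace ℝ X] [NormedAddCommGroup F]
  [NormedSpace ℝ F] {G Φ : X × F → ℝ} {ρ : F → ℝ} {U : Set F}

lemma hasDerivAt_exp_neg_mul_line (hU : IsOpen U)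
    (hG : ∀ p : X × F, p.2 ∈ U → G p = Real.exp (-Φ p) * ρ p.2)
    (hΦ : ∀ p : X × F, p.2 ∈ U → DifferentiableAt ℝ Φ p)
    (hρ : ∀ a ∈ U, DifferentiableAt ℝ ρ a) (p z : X × F) (t : ℝ) (ht : (p + t • z).2 ∈ U) :
    HasDerivAt (fun t : ℝ => G (p + t • z))
      (Real.exp (-Φ (p + t • z)) *
        (fderiv ℝ ρ (p + t • z).2 z.2 - fderiv ℝ Φ (p + t • z) z * ρ (p + t • z).2)) t := by
  have hl : HasDerivAt (fun t : ℝ => p + t • z) z t := by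
    simpa using ((hasDerivAt_id t).smul_const z).const_add p
  have h1 : HasDerivAt (fun t : ℝ => Φ (p + t • z)) (fderiv ℝ Φ (p + t • z) z) t :=
    (hΦ _ ht).hasFDerivAt.comp_hasDerivAt t hl
  have h2 : HasDerivAt (fun t : ℝ => ρ (p + t • z).2) (fderiv ℝ ρ (p + t • z).2 z.2) t :=
    (hρ _ ht).hasFDerivAt.comp_hasDerivAt t hl.snd
  have h3 := h1.neg.exp.mul h2
  have hev : (fun t : ℝ => G (p + t • z)) =ᶠ[𝓝 t]
      fun t => Real.exp (-Φ (p + t • z)) * ρ (p + t • z).2 := by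
    have hc : Continuous fun t : ℝ => (p + t • z).2 := by fun_prop
    filter_upwards [(hU.preimage hc).mem_nhds ht] with s hs
    exact hG _ hs
  refine (h3.congr_of_eventuallyEq hev).congr_deriv ?_
  simp only [Pi.neg_apply]
  ring

lemma abs_exp_neg_mul_line_deriv_le {M C R B φ r r' y n nb : ℝ} (hφ : |φ| ≤ M) (hr : |r| ≤ B)
    (hr' : |r'| ≤ R * nb) (hy : |y| ≤ C * n) :
    |Real.exp (-φ) * (r' - y * r)| ≤ Real.exp M * (R * nb + C * n * B) := by
  rw [abs_mul, Real.abs_exp]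
  have h1 : -φ ≤ M := (neg_le_abs φ).trans hφ
  have h0 : 0 ≤ C * n := (abs_nonneg _).trans hy
  gcongr
  refine (abs_sub _ _).trans ?_
  rw [abs_mul]
  gcongr

end LineDerivative

/-! ### Logarithmic derivatives of densities and the derivative of `I` -/

section Density

variable {X : Type*} [NormedAddCommGroup X] [NormedSpace ℝ X] [MeasurableSpace X] [BorelSpace X]

lemma hasFominDeriv_of_hasDerivAt {V : Type*} [AddCommGroup V] [Module ℝ V] [MeasurableSpace V]
    {lam : Measure V} {z : V} {A : Set V} {d : ℝ}
    (h : HasDerivAt (fun t : ℝ => lam.real ((fun x => x + t • z) '' A)) d 0) :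
    HasFominDeriv lam z A d := by
  have := hasDerivAt_iff_tendsto_slope_zero.1 h
  refine this.congr fun t => ?_
  simp [div_eq_inv_mul]

lemma measureReal_withDensity_ofReal {V : Type*} [MeasurableSpace V] {m : Measure V} [SFinite m]
    {g : V → ℝ} (hg : Measurable g) (h0 : ∀ p, 0 ≤ g p) (A : Set V) :
    (m.withDensity fun p => ENNReal.ofReal (g p)).real A = ∫ p in A, g p ∂m := by
  rw [integral_eq_lintegral_of_nonneg_ae (ae_of_all _ h0) hg.aestronglyMeasurable,
    measureReal_def, withDensity_apply' _ A]

/-- The Fomin derivative of a measure with density `c * G` with respect to `μ ⊗ ν`. -/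
theorem CameronMartin.hasFominDeriv_withDensity
    [CompleteSpace X] [SecondCountableTopology X] {μ : Measure X} [IsGaussian μ]
    {F : Type*} [NormedAddCommGroup F] [NormedSpace ℝ F] [MeasurableSpace F] [BorelSpace F]
    [SecondCountableTopology F] {ν : Measure F} [SFinite ν] [IsFiniteMeasureOnCompacts ν]
    [ν.IsAddRightInvariant] (hmean : ∫ x, x ∂μ = 0)
    (h : CameronMartin μ) (b : F) {G D β : X × F → ℝ} {S : Set F} (hS : IsCompact S)
    (hGm : Measurable G) (hG0 : ∀ p, 0 ≤ G p) {B : ℝ} (hGB : ∀ p, |G p| ≤ B)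
    (hGS : ∀ p, p.2 ∉ S → G p = 0) {c : ℝ} (hc : 0 ≤ c)
    {A : Set (X × F)} (hA : MeasurableSet A) {ε L : ℝ} (hε : 0 < ε) (hL : 0 ≤ L)
    (hlip : ∀ p ∈ A, ∀ s t : ℝ, |s| < ε → |t| < ε →
      |G (p + t • (h.toX, b)) - G (p + s • (h.toX, b))| ≤ L * |t - s|)
    (hder : ∀ᵐ p ∂(μ.prod ν), p ∈ A →
      HasDerivAt (fun t : ℝ => G (p + t • (h.toX, b))) (D p) 0)
    (hβ : ∀ᵐ p ∂(μ.prod ν), p ∈ A → D p - (h : Lp ℝ 2 μ) p.1 * G p = β p * G p) :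
    IntegrableOn β A ((μ.prod ν).withDensity fun p => ENNReal.ofReal (c * G p)) ∧
      HasFominDeriv ((μ.prod ν).withDensity fun p => ENNReal.ofReal (c * G p)) (h.toX, b) A
        (∫ p in A, β p ∂((μ.prod ν).withDensity fun p => ENNReal.ofReal (c * G p))) := by
  obtain ⟨hint, hderiv⟩ :=
    h.hasDerivAt_setIntegral_image_add hmean b hS hGm hGB hGS hA hε hL hlip hder
  have hcG : ∀ p, 0 ≤ c * G p := fun p => mul_nonneg hc (hG0 p)
  have hcm : Measurable fun p => c * G p := hGm.const_mul c
  have hae : (fun p => c * (D p - (h : Lp ℝ 2 μ) p.1 * G p)) =ᵐ[(μ.prod ν).restrict A]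
      fun p => (ENNReal.ofReal (c * G p)).toReal • β p := by
    filter_upwards [ae_restrict_of_ae hβ, ae_restrict_mem hA] with p hp hpA
    rw [ENNReal.toReal_ofReal (hcG p), hp hpA, smul_eq_mul]
    ring
  constructor
  · rw [IntegrableOn, restrict_withDensity hA,
      integrable_withDensity_iff_integrable_smul' hcm.ennreal_ofReal (by simp)]
    exact (Integrable.const_mul hint c).congr hae
  · refine hasFominDeriv_of_hasDerivAt ?_
    simp_rw [measureReal_withDensity_ofReal hcm hcG]
    rw [restrict_withDensity hA,
      integral_withDensity_eq_integral_toReal_smul hcm.ennreal_ofReal (by simp),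
      ← integral_congr_ae hae]
    simp_rw [integral_const_mul]
    exact hderiv.const_mul c

variable {k : ℕ}

/-- `Φ` is controlled only over `Λ`; since the prior lives on `S`, it can be replaced by a
measurable `Ψ` that agrees with it there. -/
lemma bayesPosterior_eq_withDensity {Ω : Type*} [MeasurableSpace Ω] (μ₀ : Measure Ω) [IsProbabilityMeasure μ₀]
    {S : Set (EuclideanSpace ℝ (Fin k))} {ρ : EuclideanSpace ℝ (Fin k) → ℝ} (hρm : Measurable ρ)
    (hρ_off : ∀ a, a ∉ S → ρ a = 0) [IsProbabilityMeasure (paramPrior ρ)]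
    {Φ Ψ : Ω × EuclideanSpace ℝ (Fin k) → ℝ} (hΨ : Measurable Ψ)
    (hΦΨ : ∀ p : Ω × EuclideanSpace ℝ (Fin k), p.2 ∈ S → Φ p = Ψ p) :
    ∃ c : ℝ, 0 ≤ c ∧ bayesPosterior μ₀ (paramPrior ρ) Φ = (μ₀.prod volume).withDensity
      fun p => ENNReal.ofReal (c * (Real.exp (-Ψ p) * ρ p.2)) := by
  have hρS : ∀ᵐ a ∂(paramPrior ρ), a ∈ S := by
    rw [paramPrior, ae_withDensity_iff hρm.ennreal_ofReal]
    refine ae_of_all _ fun a ha => ?_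
    by_contra haS
    simp [hρ_off a haS] at ha
  have hae : (fun p => ENNReal.ofReal (Real.exp (-Φ p))) =ᵐ[μ₀.prod (paramPrior ρ)]
      fun p => ENNReal.ofReal (Real.exp (-Ψ p)) := by
    filter_upwards [Measure.quasiMeasurePreserving_snd.ae hρS] with p hp
    rw [hΦΨ p hp]
  have hem : Measurable fun p => ENNReal.ofReal (Real.exp (-Ψ p)) := by fun_prop
  -- This makes `Z⁻¹` finite, so `toReal` loses nothing; an infinite `Z` would just give `c = 0`.
  have hZ : (∫⁻ p, ENNReal.ofReal (Real.exp (-Φ p)) ∂(μ₀.prod (paramPrior ρ))) ≠ 0 := by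
    rw [lintegral_congr_ae hae, Ne, lintegral_eq_zero_iff hem]
    intro h0
    obtain ⟨p, hp⟩ := h0.exists
    have : Real.exp (-Ψ p) ≤ 0 := by simpa using hp
    exact absurd this (not_le.2 (Real.exp_pos _))
  rw [bayesPosterior]
  set Z := ∫⁻ p, ENNReal.ofReal (Real.exp (-Φ p)) ∂(μ₀.prod (paramPrior ρ))
  refine ⟨Z⁻¹.toReal, ENNReal.toReal_nonneg, ?_⟩
  rw [withDensity_congr_ae hae]
  have hρm' : Measurable fun p : Ω × EuclideanSpace ℝ (Fin k) => ENNReal.ofReal (ρ p.2) :=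
    (hρm.comp measurable_snd).ennreal_ofReal
  rw [paramPrior, prod_withDensity_right hρm.ennreal_ofReal, ← withDensity_mul _ hρm' hem,
    ← withDensity_smul _ (hρm'.mul hem)]
  congr 1
  ext p
  have hc : ENNReal.ofReal Z⁻¹.toReal = Z⁻¹ := ENNReal.ofReal_toReal (ENNReal.inv_ne_top.2 hZ)
  rw [ENNReal.ofReal_mul ENNReal.toReal_nonneg, ENNReal.ofReal_mul (Real.exp_pos _).le, hc,
    Pi.smul_apply, Pi.mul_apply, smul_eq_mul, mul_comm (ENNReal.ofReal (ρ p.2))]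

/-- Multiplication by the density clears the denominator of `∂_b log ρ = ∂_b ρ / ρ`, leaving the
integrand of the Fomin derivative. -/
lemma posteriorLogDeriv_mul {μ₀ : Measure X} {ρ : EuclideanSpace ℝ (Fin k) → ℝ}
    {Φ : X × EuclideanSpace ℝ (Fin k) → ℝ} (ℓ : CameronMartin μ₀ → X →ₗ[ℝ] ℝ)
    (h : CameronMartin μ₀) (b : EuclideanSpace ℝ (Fin k)) {p : X × EuclideanSpace ℝ (Fin k)}
    (hΦ : DifferentiableAt ℝ Φ p) (hρ : DifferentiableAt ℝ ρ p.2) (hpos : 0 < ρ p.2) :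
    posteriorLogDeriv ρ Φ ℓ h b p * (Real.exp (-Φ p) * ρ p.2) =
      Real.exp (-Φ p) * (fderiv ℝ ρ p.2 b - fderiv ℝ Φ p (h.toX, b) * ρ p.2)
        - ℓ h p.1 * (Real.exp (-Φ p) * ρ p.2) := by
  rw [posteriorLogDeriv, hΦ.lineDeriv_eq_fderiv, (hρ.log hpos.ne').lineDeriv_eq_fderiv,
    fderiv.log hρ hpos.ne']
  simp only [smul_apply, smul_eq_mul]
  field_simp
  ring

variable [CompleteSpace X] [SecondCountableTopology X] {μ₀ : Measure X} [IsGaussian μ₀]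
  {S : Set (EuclideanSpace ℝ (Fin k))} {ρ : EuclideanSpace ℝ (Fin k) → ℝ}
  {Φ : X × EuclideanSpace ℝ (Fin k) → ℝ}

lemma gaussianOM_toX (u : CameronMartin μ₀) :
    gaussianOM μ₀ u.toX = ((1 / 2 * ‖u‖ ^ 2 : ℝ) : EReal) := by
  simp_rw [gaussianOM, CameronMartin.toX_injective.eq_iff]
  exact iInf_iInf_eq_left

lemma posteriorOMReal_eq (u : CameronMartin μ₀) {a : EuclideanSpace ℝ (Fin k)}
    (ha : a ∈ interior S) :
    posteriorOMReal μ₀ S ρ Φ (u, a) = Φ (u.toX, a) + 1 / 2 * ‖u‖ ^ 2 - Real.log (ρ a) := by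
  rw [posteriorOMReal, posteriorOM, gaussianOM_toX, paramOM, if_pos ha, ← EReal.coe_add,
    ← EReal.coe_add, EReal.toReal_coe, sub_eq_add_neg]

/-- Near the point `I` is `Φ` composed with the continuous embedding, plus `‖u‖² / 2`, minus `log
ρ`. The quadratic term has derivative `⟨u, h⟩_E`, which is `ℓ h` at `u`. -/
lemma exists_hasFDerivAt_posteriorOMReal (hmean : ∫ x, x ∂μ₀ = 0)
    {ℓ : CameronMartin μ₀ → X →ₗ[ℝ] ℝ} (hℓ : ∀ h, IsPairingVersion μ₀ h (ℓ h))
    (u : CameronMartin μ₀) {a : EuclideanSpace ℝ (Fin k)} (ha : a ∈ interior S)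
    (hΦ : DifferentiableAt ℝ Φ (u.toX, a)) (hρ : DifferentiableAt ℝ ρ a) (hpos : 0 < ρ a) :
    ∃ L : CameronMartin μ₀ × EuclideanSpace ℝ (Fin k) →L[ℝ] ℝ,
      HasFDerivAt (posteriorOMReal μ₀ S ρ Φ) L (u, a) ∧
      ∀ h b, L (h, b) = -posteriorLogDeriv ρ Φ ℓ h b (u.toX, a) := by
  have e1 : HasFDerivAt (fun p : CameronMartin μ₀ × EuclideanSpace ℝ (Fin k) => Φ (p.1.toX, p.2))
      ((fderiv ℝ Φ (u.toX, a)).comp ((CameronMartin.toXL μ₀).prodMap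
        (ContinuousLinearMap.id ℝ (EuclideanSpace ℝ (Fin k))))) (u, a) :=
    HasFDerivAt.comp (g := Φ)
      (f := (CameronMartin.toXL μ₀).prodMap (ContinuousLinearMap.id ℝ (EuclideanSpace ℝ (Fin k))))
      (u, a) hΦ.hasFDerivAt (ContinuousLinearMap.hasFDerivAt _)
  have e2 := ((hasStrictFDerivAt_norm_sq u).hasFDerivAt.comp (u, a)
    (hasFDerivAt_fst (𝕜 := ℝ) (p := (u, a)))).const_mul (1 / 2 : ℝ)
  have e3 := HasFDerivAt.comp (g := fun a => Real.log (ρ a)) (u, a)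
    (hρ.log hpos.ne').hasFDerivAt (hasFDerivAt_snd (𝕜 := ℝ) (p := (u, a)))
  refine ⟨_, ((e1.add e2).sub e3).congr_of_eventuallyEq ?_, fun h b => ?_⟩
  · filter_upwards [(isOpen_interior.preimage continuous_snd).mem_nhds
      (show (u, a).2 ∈ interior S from ha)] with p hp
    exact posteriorOMReal_eq p.1 hp
  · rw [posteriorLogDeriv, hΦ.lineDeriv_eq_fderiv, (hρ.log hpos.ne').lineDeriv_eq_fderiv,
      (hℓ h).apply_toX hmean]
    simp [CameronMartin.toXL_apply]
    ring

end Density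

lemma measurable_indicator_of_domRestrict {V : Type*} [MeasurableSpace V] {f : V → ℝ} {S T : Set V}
    (hS : MeasurableSet S) (hST : S ⊆ T) (hf : Measurable (T.domRestrict f)) :
    Measurable (S.indicator f) := by
  refine measurable_of_restrict_of_restrict_compl hS ?_ ?_
  · have e : S.domRestrict (S.indicator f) = T.domRestrict f ∘ Set.inclusion hST := by
      ext x
      simp [Set.domRestrict]
    rw [e]
    exact hf.comp (measurable_inclusion hST)
  · have e : Sᶜ.domRestrict (S.indicator f) = fun _ => 0 := by
      ext x
      exact indicator_of_notMem x.2 f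
    rw [e]
    exact measurable_const

/-- Used off `int S`, where `Φ` need not be differentiable: `|G| ≤ exp |M| * ρ` passes the zero
derivative of `ρ` on to `G`. -/
lemma hasDerivAt_zero_of_abs_le {g r : ℝ → ℝ} {C : ℝ} (hg : ∀ t, |g t| ≤ C * r t) (hr0 : r 0 = 0)
    (hr : HasDerivAt r 0 0) : HasDerivAt g 0 0 := by
  have hg0 : g 0 = 0 := by simpa [hr0] using hg 0
  rw [hasDerivAt_iff_isLittleO_nhds_zero] at hr ⊢
  simp only [zero_add, smul_zero, sub_zero, hg0, hr0] at hr ⊢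
  refine Asymptotics.IsBigO.trans_isLittleO (Asymptotics.IsBigO.of_bound |C| ?_) hr
  refine Eventually.of_forall fun t => (hg t).trans ?_
  rw [Real.norm_eq_abs, ← abs_mul]
  exact le_abs_self _

/-! ### The logarithmic derivative of the posterior -/

section Posterior

variable {X : Type*} [NormedAddCommGroup X] [NormedSpace ℝ X] [CompleteSpace X]
  [SecondCountableTopology X] [MeasurableSpace X] [BorelSpace X] {μ₀ : Measure X} [IsGaussian μ₀]
  {k : ℕ} {Λ S : Set (EuclideanSpace ℝ (Fin k))} {ρ : EuclideanSpace ℝ (Fin k) → ℝ}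
  {Φ : X × EuclideanSpace ℝ (Fin k) → ℝ}

theorem posterior_isLogDeriv (hmean : ∫ x, x ∂μ₀ = 0) (hS : IsCompact S) (hSΛ : S ⊆ Λ)
    (hρ_nonneg : ∀ a, 0 ≤ ρ a) (hρ_off : ∀ a, a ∉ S → ρ a = 0)
    [IsProbabilityMeasure (paramPrior ρ)]
    (hρ_pos : ∀ a ∈ interior S, 0 < ρ a)
    (hρ_diff : ContDiffOn ℝ 1 ρ S)
    (hΦ_meas : Measurable ((univ ×ˢ Λ).domRestrict Φ))
    (hΦ_bdd : ∃ M : ℝ, ∀ u, ∀ a ∈ Λ, |Φ (u, a)| ≤ M)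
    (hΦ_diff : ∃ C : ℝ, ∀ u, ∀ a ∈ interior Λ,
      DifferentiableAt ℝ Φ (u, a) ∧ ‖fderiv ℝ Φ (u, a)‖ ≤ C)
    {ℓ : CameronMartin μ₀ → X →ₗ[ℝ] ℝ} (hℓ : ∀ h, IsPairingVersion μ₀ h (ℓ h))
    (h : CameronMartin μ₀) (b : EuclideanSpace ℝ (Fin k)) :
    IsLogDerivWithin (bayesPosterior μ₀ (paramPrior ρ) Φ) (h.toX, b) (univ ×ˢ interior S)
        (posteriorLogDeriv ρ Φ ℓ h b) ∧
      ((∀ a ∈ frontier S, ρ a = 0) →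
        IsLogDeriv (bayesPosterior μ₀ (paramPrior ρ) Φ) (h.toX, b)
          (posteriorLogDeriv ρ Φ ℓ h b)) := by
  obtain ⟨M, hM⟩ := hΦ_bdd
  obtain ⟨C, hC⟩ := hΦ_diff
  obtain ⟨R, hR⟩ := hS.exists_bound_fderiv_interior hρ_diff
  obtain ⟨B₀, hB₀⟩ := hS.exists_bound_of_continuousOn hρ_diff.continuousOn
  have hSm : MeasurableSet S := hS.measurableSet
  have hρd : ∀ a ∈ interior S, DifferentiableAt ℝ ρ a := fun a ha =>
    (hρ_diff.contDiffAt (mem_interior_iff_mem_nhds.1 ha)).differentiableAt (by simp)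
  have hΦd : ∀ p : X × EuclideanSpace ℝ (Fin k), p.2 ∈ interior S → DifferentiableAt ℝ Φ p :=
    fun p hp => (hC p.1 p.2 (interior_mono hSΛ hp)).1
  set B := |B₀| with hBdef
  have hρB : ∀ a, |ρ a| ≤ B := fun a => by
    by_cases ha : a ∈ S
    · exact (hB₀ a ha).trans (le_abs_self _)
    · rw [hρ_off a ha, abs_zero]; positivity
  have hρm : Measurable ρ := by
    have := measurable_indicator_of_domRestrict hSm subset_rfl
      (continuousOn_iff_continuous_domRestrict.1 hρ_diff.continuousOn).measurable
    rwa [indicator_eq_self.2 fun a ha => by_contra fun h => ha (hρ_off a h)] at this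
  set Ψ : X × EuclideanSpace ℝ (Fin k) → ℝ := (univ ×ˢ S).indicator Φ with hΨdef
  have hΨm : Measurable Ψ := measurable_indicator_of_domRestrict (MeasurableSet.univ.prod hSm)
    (prod_mono_right hSΛ) hΦ_meas
  have hΦΨ : ∀ p : X × EuclideanSpace ℝ (Fin k), p.2 ∈ S → Φ p = Ψ p := fun p hp =>
    (indicator_of_mem (show p ∈ univ ×ˢ S from ⟨mem_univ _, hp⟩) Φ).symm
  have hΨM : ∀ p, |Ψ p| ≤ |M| := fun p => by
    by_cases hp : p.2 ∈ S
    · rw [← hΦΨ p hp]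
      exact (hM p.1 p.2 (hSΛ hp)).trans (le_abs_self M)
    · rw [hΨdef, indicator_of_notMem (fun h => hp h.2), abs_zero]
      positivity
  obtain ⟨c, hc, hlam⟩ := bayesPosterior_eq_withDensity μ₀ hρm hρ_off hΨm hΦΨ
  rw [hlam]
  set G : X × EuclideanSpace ℝ (Fin k) → ℝ := fun p => Real.exp (-Ψ p) * ρ p.2 with hGdef
  have hGm : Measurable G := by fun_prop
  have hG0 : ∀ p, 0 ≤ G p := fun p => mul_nonneg (Real.exp_pos _).le (hρ_nonneg _)
  have hGρ : ∀ p, |G p| ≤ Real.exp |M| * ρ p.2 := fun p => by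
    rw [abs_of_nonneg (hG0 p)]
    have := hρ_nonneg p.2
    have : -Ψ p ≤ |M| := (neg_le_abs _).trans (hΨM p)
    simp only [hGdef]
    gcongr
  have hGB : ∀ p, |G p| ≤ Real.exp |M| * B := fun p => (hGρ p).trans
    (mul_le_mul_of_nonneg_left ((le_abs_self _).trans (hρB _)) (Real.exp_pos _).le)
  have hGS : ∀ p : X × EuclideanSpace ℝ (Fin k), p.2 ∉ S → G p = 0 := fun p hp => by
    simp [hGdef, hρ_off _ hp]
  have hGΦ : ∀ p : X × EuclideanSpace ℝ (Fin k), p.2 ∈ interior S →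
      G p = Real.exp (-Φ p) * ρ p.2 := fun p hp => by rw [hΦΨ p (interior_subset hp)]
  set z : X × EuclideanSpace ℝ (Fin k) := (h.toX, b) with hz
  set D₀ : X × EuclideanSpace ℝ (Fin k) → ℝ := fun p =>
    Real.exp (-Φ p) * (fderiv ℝ ρ p.2 z.2 - fderiv ℝ Φ p z * ρ p.2) with hD₀
  have hderG : ∀ (p : X × EuclideanSpace ℝ (Fin k)) (t : ℝ), (p + t • z).2 ∈ interior S →
      HasDerivAt (fun t : ℝ => G (p + t • z)) (D₀ (p + t • z)) t := fun p t ht =>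
    hasDerivAt_exp_neg_mul_line isOpen_interior hGΦ hΦd hρd p z t ht
  have hder0 : ∀ p : X × EuclideanSpace ℝ (Fin k), p.2 ∈ interior S →
      HasDerivAt (fun t : ℝ => G (p + t • z)) (D₀ p) 0 := fun p hp => by
    have := hderG p 0 (by rwa [zero_smul, add_zero])
    rwa [zero_smul, add_zero] at this
  -- The product rule bound for `∂_z G`, from the bounds on `Φ`, `fderiv ℝ Φ`, `ρ` and `fderiv ℝ ρ`.
  set L := Real.exp |M| * (|R| * ‖z.2‖ + |C| * ‖z‖ * B)
  have hL : 0 ≤ L := by positivity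
  have hD₀L : ∀ p : X × EuclideanSpace ℝ (Fin k), p.2 ∈ interior S → |D₀ p| ≤ L := fun p hp => by
    refine abs_exp_neg_mul_line_deriv_le ?_ (hρB _) ?_ ?_
    · rw [hΦΨ p (interior_subset hp)]
      exact hΨM p
    · refine ((fderiv ℝ ρ p.2).le_opNorm z.2).trans ?_
      gcongr
      exact (hR _ hp).trans (le_abs_self _)
    · refine ((fderiv ℝ Φ p).le_opNorm z).trans ?_
      gcongr
      exact (hC p.1 p.2 (interior_mono hSΛ hp)).2.trans (le_abs_self _)
  have hver : ∀ᵐ p ∂(μ₀.prod (volume : Measure (EuclideanSpace ℝ (Fin k)))),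
      ℓ h p.1 = (h : Lp ℝ 2 μ₀) p.1 := Measure.quasiMeasurePreserving_fst.ae (hℓ h)
  have hβ : ∀ p : X × EuclideanSpace ℝ (Fin k), ℓ h p.1 = (h : Lp ℝ 2 μ₀) p.1 →
      p.2 ∈ interior S →
      D₀ p - (h : Lp ℝ 2 μ₀) p.1 * G p = posteriorLogDeriv ρ Φ ℓ h b p * G p := by
    intro p hp hpS
    rw [hGΦ p hpS, posteriorLogDeriv_mul ℓ h b (hΦd p hpS) (hρd _ hpS) (hρ_pos _ hpS), hp]
  constructor
  · rintro A hA ⟨ε, hε, hAε⟩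
    have hmem : ∀ p ∈ A, ∀ t : ℝ, |t| < ε → (p + t • z).2 ∈ interior S := fun p hp t ht =>
      (hAε t ht ⟨p, hp, rfl⟩).2
    have hmem0 : ∀ p ∈ A, p.2 ∈ interior S := fun p hp => by
      simpa using hmem p hp 0 (by simpa using hε)
    refine h.hasFominDeriv_withDensity hmean b (D := D₀) hS hGm hG0 hGB hGS hc hA hε hL ?_ ?_ ?_
    · intro p hp s t hs ht
      exact (convex_Ioo (-ε) ε).norm_image_sub_le_of_norm_hasDerivWithin_le
        (f := fun t : ℝ => G (p + t • z)) (f' := fun t => D₀ (p + t • z))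
        (fun r hr => (hderG p r (hmem p hp r (abs_lt.2 hr))).hasDerivWithinAt)
        (fun r hr => hD₀L _ (hmem p hp r (abs_lt.2 hr))) (abs_lt.1 hs) (abs_lt.1 ht)
    · refine ae_of_all _ fun p hp => ?_
      exact hder0 p (hmem0 p hp)
    · filter_upwards [hver] with p hp hpA
      exact hβ p hp (hmem0 p hpA)
  · intro hfr
    have hρ0 : ∀ a ∉ interior S, ρ a = 0 := fun a ha => by
      by_cases haS : a ∈ S
      · exact hfr a (by rw [hS.isClosed.frontier_eq]; exact ⟨haS, ha⟩)
      · exact hρ_off a haS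
    have hρc : Continuous ρ := by
      have hcont := hρ_diff.continuousOn
      rw [← hS.isClosed.closure_eq] at hcont
      have := continuous_indicator hfr hcont
      rwa [indicator_eq_self.2 fun a ha => by_contra fun h => ha (hρ_off a h)] at this
    have hρL : LipschitzWith (Real.nnabs R) ρ :=
      lipschitzWith_of_fderiv_bound_of_eq_zero isOpen_interior hρc hρ0 hρd fun a ha => by
        rw [Real.coe_nnabs]
        exact (hR a ha).trans (le_abs_self _)
    have hG00 : ∀ p : X × EuclideanSpace ℝ (Fin k), p.2 ∉ interior S → G p = 0 := fun p hp => by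
      simp [hGdef, hρ0 _ hp]
    have hcl : ∀ p : X × EuclideanSpace ℝ (Fin k), Continuous fun t : ℝ => (p + t • z).2 :=
      fun p => by fun_prop
    -- `Φ` may be discontinuous over the boundary of `S`, but there `|G| ≤ exp |M| * ρ` and `ρ`
    -- tends to `0`.
    have hGc : ∀ p, Continuous fun t : ℝ => G (p + t • z) := fun p => by
      refine continuous_iff_continuousAt.2 fun t => ?_
      by_cases ht : (p + t • z).2 ∈ interior S
      · exact (hderG p t ht).continuousAt
      · rw [ContinuousAt, hG00 _ ht]
        refine squeeze_zero_norm (fun s => hGρ (p + s • z)) ?_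
        have : Continuous fun s : ℝ => Real.exp |M| * ρ (p + s • z).2 :=
          continuous_const.mul (hρc.comp (hcl p))
        have h2 := this.tendsto t
        rwa [hρ0 _ ht, mul_zero] at h2
    have hae := Measure.quasiMeasurePreserving_snd (μ := μ₀) |>.ae
      (hρL.ae_hasFDerivAt_zero_of_nonneg volume hρ_nonneg)
    classical
    set D : X × EuclideanSpace ℝ (Fin k) → ℝ := fun p => if p.2 ∈ interior S then D₀ p else 0
    have key := fun (A : Set (X × EuclideanSpace ℝ (Fin k))) (hA : MeasurableSet A) =>
      h.hasFominDeriv_withDensity hmean b (D := D) (β := posteriorLogDeriv ρ Φ ℓ h b)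
        hS hGm hG0 hGB hGS hc hA one_pos hL
        (fun p _ s t _ _ => abs_sub_le_of_hasDerivAt_of_eq_zero
          (isOpen_interior.preimage (hcl p)) (hGc p) (fun t ht => hG00 _ ht)
          (fun t ht => hderG p t ht) (fun t ht => hD₀L _ ht) hL s t)
        (by
          filter_upwards [hae] with p hp _
          by_cases hpS : p.2 ∈ interior S
          · simp only [D, if_pos hpS]
            exact hder0 p hpS
          · simp only [D, if_neg hpS]
            refine hasDerivAt_zero_of_abs_le (r := fun t : ℝ => ρ (p + t • z).2)
              (fun t => hGρ _) (by simpa using hρ0 _ hpS) ?_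
            have hl : HasDerivAt (fun t : ℝ => (p + t • z).2) z.2 0 := by
              simpa using ((hasDerivAt_id (0 : ℝ)).smul_const z.2).const_add p.2
            have h0 : HasFDerivAt ρ (0 : EuclideanSpace ℝ (Fin k) →L[ℝ] ℝ)
                (p + (0 : ℝ) • z).2 := by simpa using hp (hρ0 _ hpS)
            simpa using! h0.comp_hasDerivAt (0 : ℝ) hl)
        (by
          filter_upwards [hver] with p hp _
          by_cases hpS : p.2 ∈ interior S
          · simpa [D, hpS] using hβ p hp hpS
          -- Off `int S` the density is zero, so the values of the candidate `β` there are
          -- irrelevant.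
          · simp [D, hpS, hG00 p hpS])
    refine ⟨fun A hA => ⟨_, (key A hA).2⟩, ?_, fun A hA => (key A hA).2⟩
    simpa using (key univ MeasurableSet.univ).1

end Posterior

theorem mainTheorem9
    {X : Type*} [NormedAddCommGroup X] [NormedSpace ℝ X] [CompleteSpace X]
    [SecondCountableTopology X] [MeasurableSpace X] [BorelSpace X]
    (μ₀ : Measure X) [IsGaussian μ₀] (hmean : ∫ x, x ∂μ₀ = 0)
    {k : ℕ} (Λ S : Set (EuclideanSpace ℝ (Fin k))) (hS : IsCompact S) (hSΛ : S ⊆ Λ)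
    (ρ : EuclideanSpace ℝ (Fin k) → ℝ)
    (hρ_nonneg : ∀ a, 0 ≤ ρ a) (hρ_off : ∀ a, a ∉ S → ρ a = 0)
    [IsProbabilityMeasure (paramPrior ρ)]
    (hρ_pos : ∀ a ∈ interior S, 0 < ρ a)
    (hρ_diff : ContDiffOn ℝ 1 ρ S)
    (Φ : X × EuclideanSpace ℝ (Fin k) → ℝ)
    (hΦ_meas : Measurable ((univ ×ˢ Λ).domRestrict Φ))
    (hΦ_bdd : ∃ M : ℝ, ∀ u, ∀ a ∈ Λ, |Φ (u, a)| ≤ M)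
    (hΦ_diff : ∃ C : ℝ, ∀ u, ∀ a ∈ interior Λ,
      DifferentiableAt ℝ Φ (u, a) ∧ ‖fderiv ℝ Φ (u, a)‖ ≤ C) :
    -- versions of `⟨·, h⟩_E` exist
    (∃ ℓ : CameronMartin μ₀ → X →ₗ[ℝ] ℝ, ∀ h, IsPairingVersion μ₀ h (ℓ h)) ∧
    -- and, whichever versions are used:
    ∀ ℓ : CameronMartin μ₀ → X →ₗ[ℝ] ℝ, (∀ h, IsPairingVersion μ₀ h (ℓ h)) →
      -- they extend the inner product of `E`
      (∀ h u : CameronMartin μ₀, ℓ h u.toX = inner ℝ u h) ∧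
      -- formula for the logarithmic derivative on `X × int S`
      (∀ (h : CameronMartin μ₀) (b : EuclideanSpace ℝ (Fin k)),
        IsLogDerivWithin (bayesPosterior μ₀ (paramPrior ρ) Φ) (h.toX, b) (univ ×ˢ interior S)
          (posteriorLogDeriv ρ Φ ℓ h b)) ∧
      -- on the whole space if `ρ` vanishes on the boundary of `S`
      ((∀ a ∈ frontier S, ρ a = 0) →
        ∀ (h : CameronMartin μ₀) (b : EuclideanSpace ℝ (Fin k)),
          IsLogDeriv (bayesPosterior μ₀ (paramPrior ρ) Φ) (h.toX, b)
            (posteriorLogDeriv ρ Φ ℓ h b)) ∧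
      -- it is minus the derivative of `I` along `(h, b)`
      (∀ (u : CameronMartin μ₀), ∀ a ∈ interior S,
        ∀ (h : CameronMartin μ₀) (b : EuclideanSpace ℝ (Fin k)),
          HasLineDerivAt ℝ (posteriorOMReal μ₀ S ρ Φ)
            (-posteriorLogDeriv ρ Φ ℓ h b (u.toX, a)) (u, a) (h, b)) ∧
      -- critical points of `I`
      (∀ (u : CameronMartin μ₀), ∀ a ∈ interior S,
        HasFDerivAt (posteriorOMReal μ₀ S ρ Φ)
            (0 : CameronMartin μ₀ × EuclideanSpace ℝ (Fin k) →L[ℝ] ℝ) (u, a) ↔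
          ∀ (h : CameronMartin μ₀) (b : EuclideanSpace ℝ (Fin k)),
            posteriorLogDeriv ρ Φ ℓ h b (u.toX, a) = 0) := by
  refine ⟨⟨fun h => (exists_isPairingVersion h).choose,
    fun h => (exists_isPairingVersion h).choose_spec⟩, fun ℓ hℓ => ?_⟩
  have hlog := posterior_isLogDeriv hmean hS hSΛ hρ_nonneg hρ_off hρ_pos hρ_diff hΦ_meas hΦ_bdd
    hΦ_diff hℓ
  -- As `I` is Fréchet differentiable at every such point, being critical means `L = 0`, that is,
  -- all values `L (h, b)` vanish.
  have hI : ∀ (u : CameronMartin μ₀), ∀ a ∈ interior S,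
      ∃ L : CameronMartin μ₀ × EuclideanSpace ℝ (Fin k) →L[ℝ] ℝ,
        HasFDerivAt (posteriorOMReal μ₀ S ρ Φ) L (u, a) ∧
        ∀ h b, L (h, b) = -posteriorLogDeriv ρ Φ ℓ h b (u.toX, a) := by
    intro u a ha
    obtain ⟨C, hC⟩ := hΦ_diff
    exact exists_hasFDerivAt_posteriorOMReal hmean hℓ u ha (hC _ a (interior_mono hSΛ ha)).1
      ((hρ_diff.contDiffAt (mem_interior_iff_mem_nhds.1 ha)).differentiableAt (by simp))
      (hρ_pos a ha)
  refine ⟨fun h u => (hℓ h).apply_toX hmean u, fun h b => (hlog h b).1,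
    fun hfr h b => (hlog h b).2 hfr, fun u a ha h b => ?_, fun u a ha => ?_⟩
  · obtain ⟨L, hL, hLβ⟩ := hI u a ha
    rw [← hLβ]
    exact hL.hasLineDerivAt (h, b)
  · obtain ⟨L, hL, hLβ⟩ := hI u a ha
    constructor
    · intro h0 h b
      have : L = 0 := hL.unique h0
      rw [← neg_eq_zero, ← hLβ, this]
      rfl
    · intro h0
      have : L = 0 := by
        refine ContinuousLinearMap.ext fun p => ?_
        change L (p.1, p.2) = 0
        rw [hLβ, h0, neg_zero]
      rwa [← this]
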